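/- **Preferential attachment with a changepoint.** Let $m\ge 1$ be an integer, let $-m<\delta_{\min}\le\delta_{\max}$, let $\delta_0,\delta_1\in(\delta_{\min},\delta_{\max})$, $c>0$ and $\tfrac12<\gamma<1$ be fixed, and let $\tau_n\in\mathbb N$ be $n-cn^{\gamma}$ rounded to a neighbouring integer (that is, $|\tau_n-(n-cn^\gamma)|<1$ for all large $n$). For a function $\delta(\cdot)$ with values in $(-m,\infty)$, let $G_1$ be the multigraph with vertices $v_0,v_1$ joined by $m$ edges, and for $t\ge 2$ obtain $G_t$ from $G_{t-1}$ by adding a vertex $v_t$ and then, one after the other, $m$ edges between $v_t$ and vertices of $\{v_0,\dots,v_{t-1}\}$. Here the endpoint of each new edge is $v$ with conditional probability $$\frac{D_v+\delta(t)}{\sum_{j=0}^{t-1}(D_{v_j}+\delta(t))},\qquad v\in\{v_0,\dots,v_{t-1}\},$$ where $D$ denotes the degrees in the graph just before that edge is added. Let $\mathbb E_0$ be the expectation for $\delta(t)=\delta_0$ for all $t$ and, for the graph $G_n$, let $\mathbb E_1$ be the expectation for $\delta(t)=\delta_0$ if $t\le\tau_n$ and $\delta(t)=\delta_1$ if $t>\tau_n$.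 Let $N_{>k}(n)$ be the number of vertices of degree larger than $k$ in $G_n$, and define the score function (the derivative in $\delta$ of the normalized log-likelihood of the model with constant parameter $\delta$) $$\iota_n'(\delta)=\frac1{n+1}\sum_{k=m}^\infty\frac{N_{>k}(n)}{k+\delta}-\frac1{n+1}\sum_{t=2}^n\sum_{i=1}^m\frac{t}{t\delta+2m(t-1)+(i-1)} .$$ For $k\ge m$ let $$p_k(\delta_0)=(2+\delta_0/m)\,\frac{\Gamma(k+\delta_0)\,\Gamma(m+2+\delta_0+\delta_0/m)}{\Gamma(m+\delta_0)\,\Gamma(k+3+\delta_0+\delta_0/m)} .$$ **Proposition.** As $n\to\infty$, uniformly in $\delta\in[\delta_{\min},\delta_{\max}]$, $$(n+1)\bigl(\mathbb E_1[\iota_n'(\delta)]-\mathbb E_0[\iota_n'(\delta)]\bigr)=\kappa(\delta_1,\delta_0,\delta)\,n^{\gamma}\,(1+o(1)),$$ where $$\kappa(\delta_1,\delta_0,\delta)=(\delta_1-\delta_0)\,\frac{cm}{(2m+\delta_1)(2m+\delta_0)}\Bigl(-1+\sum_{k\ge m}\frac{2m+\delta}{k+\delta}\,p_k(\delta_0)\Bigr),$$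 the series being convergent for every $\delta\in[\delta_{\min},\delta_{\max}]$. -/

import Mathlib

open Filter Topology
open scoped ENNReal

namespace PrefAttach

noncomputable section

/-- A multigraph without loops, given by the multiset of its edges. The vertices
`v_0, v_1, …` are the natural numbers; at time `t` the vertex set is `{0, …, t}`. -/
abbrev Graph : Type := Multiset (Sym2 ℕ)

/-- The degree of the vertex `v`: the number of edges, with multiplicity, that contain `v`. -/
def degree (G : Graph) (v : ℕ) : ℕ := G.countP (fun e => v ∈ e)

/-- The number of vertices of degree larger than `k` in a graph with vertex set `{0, …, n}`. -/
def numDegGT (n k : ℕ) (G : Graph) : ℕ :=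
  ((Finset.range (n + 1)).filter (fun v => k < degree G v)).card

/-- The probability that a new edge of vertex `t` is attached to `v`, if the current graph is `G`
and the attachment function is `k ↦ k + a`. -/
def attachProb (t : ℕ) (a : ℝ) (G : Graph) (v : ℕ) : ℝ≥0∞ :=
  if v ∈ Finset.range t then
    ENNReal.ofReal ((degree G v + a) / ∑ j ∈ Finset.range t, ((degree G j : ℝ) + a))
  else 0

/-- The attachment probabilities sum to one as soon as all the weights `D_v + a` are positive. -/
theorem sum_attachProb (t : ℕ) (a : ℝ) (G : Graph) (ht : 0 < t)
    (h : ∀ v < t, 0 < (degree G v : ℝ) + a) :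
    ∑ v ∈ Finset.range t, attachProb t a G v = 1 := by
  have hpos : 0 < ∑ j ∈ Finset.range t, ((degree G j : ℝ) + a) :=
    Finset.sum_pos (fun v hv => h v (Finset.mem_range.mp hv)) ⟨0, Finset.mem_range.mpr ht⟩
  have h1 : ∀ v ∈ Finset.range t, attachProb t a G v =
      ENNReal.ofReal ((degree G v + a) / ∑ j ∈ Finset.range t, ((degree G j : ℝ) + a)) :=
    fun v hv => by rw [attachProb, if_pos hv]
  rw [Finset.sum_congr rfl h1, ← ENNReal.ofReal_sum_of_nonneg, ← Finset.sum_div,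
    div_self hpos.ne', ENNReal.ofReal_one]
  intro v hv
  exact div_nonneg (h v (Finset.mem_range.mp hv)).le hpos.le

open Classical in
/-- The law of the vertex in `{0, …, t - 1}` to which a new edge of vertex `t` is attached.
The second branch is a convention that never occurs in the process below if the parameters
exceed `-m`, since then all degrees of vertices below `t` are at least `m`. -/
def attachLaw (t : ℕ) (a : ℝ) (G : Graph) : PMF ℕ :=
  if h : ∑ v ∈ Finset.range t, attachProb t a G v = 1 then
    PMF.ofFinset (attachProb t a G) (Finset.range t) h (fun v hv => by rw [attachProb, if_neg hv])
  else PMF.pure 0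

/-- Add one random edge between the vertex `t` and a vertex in `{0, …, t - 1}`. -/
def addEdge (t : ℕ) (a : ℝ) (G : Graph) : PMF Graph :=
  (attachLaw t a G).map (fun v => s(v, t) ::ₘ G)

/-- Add `i` random edges to the vertex `t`, one after the other, updating the degrees. -/
def addEdges (t : ℕ) (a : ℝ) : ℕ → Graph → PMF Graph
  | 0, G => PMF.pure G
  | i + 1, G => (addEdges t a i G).bind (addEdge t a)

/-- The law of the preferential attachment graph `G_n` with `m` edges per vertex and attachment
parameter `d t` at time `t`. The seed `G_1` consists of the vertices `0` and `1` joined by `m`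
edges (the value at time `0` plays no role). -/
def graphLaw (m : ℕ) (d : ℕ → ℝ) : ℕ → PMF Graph
  | 0 => PMF.pure 0
  | 1 => PMF.pure (Multiset.replicate m s(0, 1))
  | n + 2 => (graphLaw m d (n + 1)).bind (addEdges (n + 2) (d (n + 2)) m)

/-- The attachment parameter of the null model. -/
def nullParam (δ₀ : ℝ) : ℕ → ℝ := fun _ => δ₀

/-- The attachment parameter of the alternative model with changepoint `τ`. -/
def altParam (δ₀ δ₁ : ℝ) (τ : ℕ) : ℕ → ℝ := fun t => if t ≤ τ then δ₀ else δ₁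

/-- The expectation of a real function under a discrete law. -/
def expect {α : Type*} (p : PMF α) (f : α → ℝ) : ℝ := ∑' x, (p x).toReal * f x

/-- The normalizing constant `S_{t,i}(δ) = t δ + 2 m (t - 1) + i`. -/
def normConst (m t i : ℕ) (δ : ℝ) : ℝ := t * δ + 2 * m * ((t : ℝ) - 1) + i

/-- The normalized log-likelihood function of the null model with parameter `δ`. -/
def logLik (m n : ℕ) (δ : ℝ) (G : Graph) : ℝ :=
  1 / ((n : ℝ) + 1) * ∑' j : ℕ, Real.log (((m + j : ℕ) : ℝ) + δ) * numDegGT n (m + j) G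
    - 1 / ((n : ℝ) + 1) *
      ∑ t ∈ Finset.Icc 2 n, ∑ i ∈ Finset.range m, Real.log (normConst m t i δ)

/-- The score function, the derivative of the normalized log-likelihood in `δ`. In the series,
which has finitely many nonzero terms, `k = m + j` runs over the integers `k ≥ m`. -/
def score (m n : ℕ) (δ : ℝ) (G : Graph) : ℝ :=
  1 / ((n : ℝ) + 1) * ∑' j : ℕ, 1 / (((m + j : ℕ) : ℝ) + δ) * numDegGT n (m + j) G
    - 1 / ((n : ℝ) + 1) *
      ∑ t ∈ Finset.Icc 2 n, ∑ i ∈ Finset.range m, (t : ℝ) / normConst m t i δ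

theorem numDegGT_eq_zero (n k : ℕ) (G : Graph) (hk : G.card ≤ k) : numDegGT n k G = 0 := by
  rw [numDegGT, Finset.card_eq_zero, Finset.filter_eq_empty_iff]
  intro v _
  have : degree G v ≤ G.card := Multiset.countP_le_card _ _
  omega

/-- The score function is the derivative of the log-likelihood. -/
theorem hasDerivAt_logLik (m n : ℕ) (hm : 1 ≤ m) (δ : ℝ) (hδ : -(m : ℝ) < δ) (G : Graph) :
    HasDerivAt (fun x => logLik m n x G) (score m n δ G) δ := by
  have hfin : ∀ f : ℕ → ℝ, ∑' j : ℕ, f j * (numDegGT n (m + j) G : ℝ) =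
      ∑ j ∈ Finset.range G.card, f j * (numDegGT n (m + j) G : ℝ) := by
    intro f
    refine tsum_eq_sum fun j hj => ?_
    rw [numDegGT_eq_zero n (m + j) G (by simp at hj; omega)]
    simp
  have hm' : (1 : ℝ) ≤ m := by exact_mod_cast hm
  simp only [logLik, score]
  refine HasDerivAt.sub (HasDerivAt.const_mul _ ?_) (HasDerivAt.const_mul _ ?_)
  · rw [hfin]
    have : (fun x : ℝ => ∑' j : ℕ, Real.log (((m + j : ℕ) : ℝ) + x) * (numDegGT n (m + j) G : ℝ)) =
        fun x : ℝ => ∑ j ∈ Finset.range G.card,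
          Real.log (((m + j : ℕ) : ℝ) + x) * (numDegGT n (m + j) G : ℝ) := by
      funext x
      exact hfin _
    rw [this]
    refine HasDerivAt.fun_sum fun j _ => ?_
    have hne : ((m + j : ℕ) : ℝ) + δ ≠ 0 := by
      push_cast
      have : (0 : ℝ) ≤ j := Nat.cast_nonneg j
      linarith
    exact (HasDerivAt.log ((hasDerivAt_id δ).const_add _) hne).mul_const _
  · refine HasDerivAt.fun_sum fun t ht => HasDerivAt.fun_sum fun i _ => ?_
    have ht2 : (2 : ℝ) ≤ t := by exact_mod_cast (Finset.mem_Icc.mp ht).1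
    have hpos : 0 < normConst m t i δ := by
      rw [normConst]
      have hi : (0 : ℝ) ≤ i := Nat.cast_nonneg i
      nlinarith [mul_pos (by linarith : (0 : ℝ) < t) (by linarith : (0 : ℝ) < δ + m),
        mul_nonneg (by linarith : (0 : ℝ) ≤ m) (by linarith : (0 : ℝ) ≤ (t : ℝ) - 2)]
    have hd : HasDerivAt (fun x => normConst m t i x) (t : ℝ) δ := by
      unfold normConst
      simpa using
        (((hasDerivAt_id δ).const_mul (t : ℝ)).add_const (2 * m * ((t : ℝ) - 1))).add_const (i : ℝ)
    exact hd.log hpos.ne'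

/-- The limiting degree distribution `p_k(δ₀)`, `k ≥ m`, of the null model. -/
def degDist (m : ℕ) (δ₀ : ℝ) (k : ℕ) : ℝ :=
  (2 + δ₀ / m) * (Real.Gamma (k + δ₀) * Real.Gamma (m + 2 + δ₀ + δ₀ / m)) /
    (Real.Gamma (m + δ₀) * Real.Gamma (k + 3 + δ₀ + δ₀ / m))

/-- The term with index `k = m + j` of the series in the constant `kappa`. -/
def kappaTerm (m : ℕ) (δ₀ δ : ℝ) (j : ℕ) : ℝ :=
  (2 * m + δ) / (((m + j : ℕ) : ℝ) + δ) * degDist m δ₀ (m + j)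

/-- The constant `κ(δ₁, δ₀, δ)`. -/
def kappa (m : ℕ) (c δ₁ δ₀ δ : ℝ) : ℝ :=
  (δ₁ - δ₀) * (c * m / ((2 * m + δ₁) * (2 * m + δ₀))) * (-1 + ∑' j : ℕ, kappaTerm m δ₀ δ j)

end

end PrefAttach

/-! Up to a deterministic term, which cancels in the difference, (n + 1) times the score is the sum
over the vertices of h(D_v), where h(k + 1) - h(k) = 1 / (k + δ). An edge attached with parameter b
at time t therefore raises the mean of this sum by the mean of Σ_v (D_v + b) / (D_v + δ) divided by
the deterministic total weight, that is, by (t + (b - δ) Σ_v E[1 / (D_v + δ)]) / S with S ≈ t (2m +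
b).

Under the null law with parameter a = δ₀ the average of 1 / (D_v + δ) has mean converging to y = Σ_k
p_k / (k + δ), uniformly in δ (`tendsto_tail`, `eventually_abs_meanSum_inv_sub_le`). Since γ < 1,
only o(n) vertices arrive after the changepoint, and the average stays near y whatever parameter is
then used (`abs_meanSum_inv_sub_le_of_change`). So each late edge contributes `drift m a b δ` + o(1)
under the alternative (b = δ₁) and `drift m a a δ` + o(1) under the null. Both laws agree up to the
changepoint, and about c m n^γ edges follow it; this gives the constant by `kappa_eq_drift`. No
coupling or concentration is needed, because the means obey closed linear recursions.

A relative error also requires κ to stay away from 0 uniformly in δ. This is a strict Jensen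
inequality for x ↦ 1 / (x + δ), the limiting mean degree being at most 2m (`jensen_kappaTerm`,
`exists_le_abs_kappa`). -/

namespace PrefAttach

noncomputable section

/-! ### Expectations under finitely supported laws -/

section Expect

variable {α β : Type*}

theorem summable_expect {p : PMF α} (hp : p.support.Finite) (f : α → ℝ) :
    Summable fun x => (p x).toReal * f x := by
  refine summable_of_hasFiniteSupport (hp.subset fun x hx => ?_)
  rw [PMF.mem_support_iff]
  rintro h
  simp [h] at hx

theorem expect_eq_sum {p : PMF α} {s : Finset α} (hs : ∀ x ∈ p.support, x ∈ s) (f : α → ℝ) :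
    expect p f = ∑ x ∈ s, (p x).toReal * f x := by
  refine tsum_eq_sum fun x hx => ?_
  have : p x = 0 := by
    by_contra h
    exact hx (hs x ((PMF.mem_support_iff _ _).2 h))
  simp [this]

theorem expect_add {p : PMF α} (hp : p.support.Finite) (f g : α → ℝ) :
    expect p (fun x => f x + g x) = expect p f + expect p g := by
  simp only [expect, mul_add]
  exact (summable_expect hp f).tsum_add (summable_expect hp g)

theorem expect_const_mul (p : PMF α) (c : ℝ) (f : α → ℝ) :
    expect p (fun x => c * f x) = c * expect p f := by
  simp only [expect, mul_left_comm _ c]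
  exact tsum_mul_left

theorem expect_const (p : PMF α) (c : ℝ) : expect p (fun _ => c) = c := by
  simp only [expect, tsum_mul_right]
  rw [← ENNReal.tsum_toReal_eq fun x => p.apply_ne_top x, p.tsum_coe, ENNReal.toReal_one, one_mul]

theorem expect_congr {p : PMF α} {f g : α → ℝ} (h : ∀ x ∈ p.support, f x = g x) :
    expect p f = expect p g := by
  refine tsum_congr fun x => ?_
  by_cases hx : x ∈ p.support
  · rw [h x hx]
  · rw [PMF.mem_support_iff, not_not] at hx
    simp [hx]

theorem expect_mono {p : PMF α} (hp : p.support.Finite) {f g : α → ℝ}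
    (h : ∀ x ∈ p.support, f x ≤ g x) : expect p f ≤ expect p g := by
  refine (summable_expect hp f).tsum_le_tsum (fun x => ?_) (summable_expect hp g)
  by_cases hx : x ∈ p.support
  · exact mul_le_mul_of_nonneg_left (h x hx) ENNReal.toReal_nonneg
  · rw [PMF.mem_support_iff, not_not] at hx
    simp [hx]

theorem finite_support_bind {p : PMF α} (hp : p.support.Finite) {f : α → PMF β}
    (hf : ∀ a ∈ p.support, (f a).support.Finite) : (p.bind f).support.Finite := by
  rw [PMF.support_bind]
  exact hp.biUnion hf

theorem expect_bind {p : PMF α} (hp : p.support.Finite) {f : α → PMF β}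
    (hf : ∀ a ∈ p.support, (f a).support.Finite) (g : β → ℝ) :
    expect (p.bind f) g = expect p fun a => expect (f a) g := by
  have hb := finite_support_bind hp hf
  rw [expect_eq_sum (s := hb.toFinset) (by simp),
    expect_eq_sum (p := p) (s := hp.toFinset) (by simp)]
  have h1 : ∀ x, ((p.bind f) x).toReal = ∑ a ∈ hp.toFinset, (p a).toReal * (f a x).toReal := by
    intro x
    rw [PMF.bind_apply, tsum_eq_sum (s := hp.toFinset), ENNReal.toReal_sum]
    · simp only [ENNReal.toReal_mul]
    · exact fun a _ => ENNReal.mul_ne_top (p.apply_ne_top a) ((f a).apply_ne_top x)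
    · intro a ha
      simp only [Set.Finite.mem_toFinset, PMF.mem_support_iff, not_not] at ha
      rw [ha, zero_mul]
  simp only [h1, Finset.sum_mul]
  rw [Finset.sum_comm]
  refine Finset.sum_congr rfl fun a ha => ?_
  rw [expect_eq_sum (p := f a) (s := hb.toFinset), Finset.mul_sum]
  · simp only [mul_assoc]
  · intro x hx
    rw [Set.Finite.mem_toFinset, PMF.mem_support_bind_iff]
    exact ⟨a, by simpa using ha, hx⟩

theorem expect_pure (a : α) (g : α → ℝ) : expect (PMF.pure a) g = g a := by
  rw [expect_eq_sum (s := {a}) (by simp)]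
  simp

theorem expect_map {p : PMF α} (hp : p.support.Finite) (f : α → β) (g : β → ℝ) :
    expect (p.map f) g = expect p fun a => g (f a) := by
  rw [PMF.map, expect_bind hp fun a _ => by simp]
  exact tsum_congr fun a => congrArg _ (expect_pure (f a) g)

end Expect

/-! ### Structure of the graphs and the effect of one edge -/

/-- The graphs that can occur after `i` edges of the vertex `t` have been added. -/
structure IsStage (m t i : ℕ) (G : Graph) : Prop where
  le_degree : ∀ v < t, m ≤ degree G v
  degree_self : degree G t = i
  degree_eq_zero : ∀ v, t < v → degree G v = 0
  -- Each of the m (t - 1) edges of the previous graph counts twice; each of the i new edges counts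
  -- once, as `t` itself is outside the sum.
  sum_degree : ∑ v ∈ Finset.range t, (degree G v : ℝ) = 2 * m * ((t : ℝ) - 1) + i

theorem degree_cons (G : Graph) {v t : ℕ} (w : ℕ) :
    degree (s(v, t) ::ₘ G) w = degree G w + if w = v ∨ w = t then 1 else 0 := by
  simp [degree, Multiset.countP_cons]

theorem IsStage.cons {m t i : ℕ} {G : Graph} (h : IsStage m t i G) {v : ℕ} (hv : v < t) :
    IsStage m t (i + 1) (s(v, t) ::ₘ G) where
  le_degree w hw := by
    rw [degree_cons]
    exact (h.le_degree w hw).trans (Nat.le_add_right _ _)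
  degree_self := by simp [degree_cons, h.degree_self]
  degree_eq_zero w hw := by
    rw [degree_cons, h.degree_eq_zero w hw, if_neg (by omega)]
  sum_degree := by
    have : ∀ w ∈ Finset.range t, (degree (s(v, t) ::ₘ G) w : ℝ) =
        degree G w + if w = v then 1 else 0 := by
      intro w hw
      rw [Finset.mem_range] at hw
      simp [degree_cons, hw.ne]
    rw [Finset.sum_congr rfl this, Finset.sum_add_distrib, h.sum_degree]
    simp [hv]
    ring

theorem IsStage.next {m t : ℕ} {G : Graph} (h : IsStage m t m G) : IsStage m (t + 1) 0 G where
  le_degree v hv := by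
    rcases Nat.lt_succ_iff_lt_or_eq.1 hv with hv | rfl
    · exact h.le_degree v hv
    · exact h.degree_self.ge
  degree_self := h.degree_eq_zero _ t.lt_succ_self
  degree_eq_zero v hv := h.degree_eq_zero v (by omega)
  sum_degree := by
    rw [Finset.sum_range_succ, h.sum_degree, h.degree_self]
    push_cast
    ring

theorem isStage_seed (m : ℕ) : IsStage m 2 0 (Multiset.replicate m s(0, 1)) := by
  have hd : ∀ v, degree (Multiset.replicate m s(0, 1)) v = if v = 0 ∨ v = 1 then m else 0 := by
    intro v
    rw [degree, Multiset.countP_eq_card_filter]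
    split_ifs with hv
    · rw [Multiset.filter_eq_self.2, Multiset.card_replicate]
      intro a ha
      rw [Multiset.eq_of_mem_replicate ha]
      simpa using hv
    · rw [Multiset.card_eq_zero, Multiset.filter_eq_nil]
      intro a ha
      rw [Multiset.eq_of_mem_replicate ha]
      simpa using hv
  refine ⟨fun v hv => ?_, by simp [hd], fun v hv => ?_, ?_⟩
  · rw [hd, if_pos (by omega)]
  · rw [hd, if_neg (by omega)]
  · simp [Finset.sum_range_succ, hd]
    ring

/-- The sum of a function of the degrees over the vertices below `t`. -/
def degSum (f : ℕ → ℝ) (t : ℕ) (G : Graph) : ℝ := ∑ v ∈ Finset.range t, f (degree G v)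

theorem normConst_eq {m t i : ℕ} {G : Graph} (h : IsStage m t i G) (a : ℝ) :
    ∑ v ∈ Finset.range t, ((degree G v : ℝ) + a) = normConst m t i a := by
  rw [Finset.sum_add_distrib, h.sum_degree, normConst]
  simp
  ring

/-- Because 2 (t - 1) ≥ t for t ≥ 2. Besides positivity, this bounds the mean change caused by one
edge. -/
theorem le_normConst {m t : ℕ} (ht : 2 ≤ t) (i : ℕ) (a : ℝ) :
    t * (m + a) ≤ normConst m t i a := by
  have h2 : (2 : ℝ) ≤ t := by exact_mod_cast ht
  have hm : (0 : ℝ) ≤ m := Nat.cast_nonneg m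
  have hi : (0 : ℝ) ≤ i := Nat.cast_nonneg i
  rw [normConst]
  nlinarith [mul_nonneg hm (sub_nonneg.2 h2)]

theorem normConst_pos {m t : ℕ} (ht : 2 ≤ t) (i : ℕ) {a : ℝ} (ha : -(m : ℝ) < a) :
    0 < normConst m t i a := by
  have h2 : (0 : ℝ) < t := by exact_mod_cast (by omega : 0 < t)
  exact (mul_pos h2 (by linarith)).trans_le (le_normConst ht i a)

section AddEdge

variable {m t i : ℕ} {G : Graph} {a : ℝ}

theorem attachLaw_apply (h : IsStage m t i G) (ht : 2 ≤ t) (ha : -(m : ℝ) < a) (v : ℕ) :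
    attachLaw t a G v = attachProb t a G v := by
  rw [attachLaw, dif_pos (sum_attachProb t a G (by omega) fun v hv => ?_), PMF.ofFinset_apply]
  have : (m : ℝ) ≤ degree G v := by exact_mod_cast h.le_degree v hv
  linarith

theorem attachLaw_support (h : IsStage m t i G) (ht : 2 ≤ t) (ha : -(m : ℝ) < a) :
    ∀ v ∈ (attachLaw t a G).support, v ∈ Finset.range t := by
  intro v hv
  rw [PMF.mem_support_iff, attachLaw_apply h ht ha, attachProb] at hv
  by_contra hv'
  exact hv (if_neg hv')

theorem attachLaw_finite (h : IsStage m t i G) (ht : 2 ≤ t) (ha : -(m : ℝ) < a) :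
    (attachLaw t a G).support.Finite :=
  (Finset.finite_toSet _).subset fun v hv => attachLaw_support h ht ha v hv

theorem addEdge_support (h : IsStage m t i G) (ht : 2 ≤ t) (ha : -(m : ℝ) < a) :
    ∀ G' ∈ (addEdge t a G).support, IsStage m t (i + 1) G' := by
  intro G' hG'
  rw [addEdge, PMF.mem_support_map_iff] at hG'
  obtain ⟨v, hv, rfl⟩ := hG'
  exact h.cons (Finset.mem_range.1 (attachLaw_support h ht ha v hv))

theorem addEdge_finite (h : IsStage m t i G) (ht : 2 ≤ t) (ha : -(m : ℝ) < a) :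
    (addEdge t a G).support.Finite := by
  rw [addEdge, PMF.support_map]
  exact (attachLaw_finite h ht ha).image _

/-- The vertex `t` is not summed over, so an edge to `v` changes only the term f(D_v), and it is
chosen with probability (D_v + a) / S. -/
theorem expect_addEdge (h : IsStage m t i G) (ht : 2 ≤ t) (ha : -(m : ℝ) < a) (f : ℕ → ℝ) :
    expect (addEdge t a G) (degSum f t) =
      degSum f t G +
        degSum (fun x => (f (x + 1) - f x) * (x + a)) t G / normConst m t i a := by
  have hS := normConst_pos ht i ha
  have hcons : ∀ v ∈ Finset.range t, degSum f t (s(v, t) ::ₘ G) =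
      degSum f t G + (f (degree G v + 1) - f (degree G v)) := by
    intro v hv
    have : ∀ w ∈ Finset.range t, f (degree (s(v, t) ::ₘ G) w) =
        f (degree G w) + if w = v then f (degree G v + 1) - f (degree G v) else 0 := by
      intro w hw
      rw [Finset.mem_range] at hw
      rw [degree_cons]
      by_cases hwv : w = v
      · subst hwv; simp
      · simp [hwv, hw.ne]
    rw [degSum, Finset.sum_congr rfl this, Finset.sum_add_distrib, Finset.sum_ite_eq' , if_pos hv,
      degSum]
  have hprob : ∀ v ∈ Finset.range t,
      (attachLaw t a G v).toReal = (degree G v + a) / normConst m t i a := by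
    intro v hv
    rw [attachLaw_apply h ht ha, attachProb, if_pos hv, normConst_eq h, ENNReal.toReal_ofReal]
    have : (m : ℝ) ≤ degree G v := by exact_mod_cast h.le_degree v (Finset.mem_range.1 hv)
    exact div_nonneg (by linarith) hS.le
  rw [addEdge, expect_map (attachLaw_finite h ht ha),
    expect_eq_sum (attachLaw_support h ht ha),
    Finset.sum_congr rfl fun v hv => by rw [hprob v hv, hcons v hv, mul_add],
    Finset.sum_add_distrib, ← Finset.sum_mul, ← Finset.sum_div, normConst_eq h, div_self hS.ne',
    one_mul]
  simp only [degSum, Finset.sum_div]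
  congr 1
  exact Finset.sum_congr rfl fun v _ => by ring

end AddEdge

/-! ### Evolution of mean degree sums -/

/-- The law of the graph after `i` edges of the vertex `n + 2` have been added. -/
def stepLaw (m : ℕ) (d : ℕ → ℝ) (n i : ℕ) : PMF Graph :=
  (graphLaw m d (n + 1)).bind (addEdges (n + 2) (d (n + 2)) i)

section StepLaw

variable {m : ℕ} {d : ℕ → ℝ}

/-- The index `n` refers to the vertex `n + 2`, so stage 0 is the graph at time `n + 1`, which has
`n + 2` vertices. -/
theorem stepLaw_zero (m : ℕ) (d : ℕ → ℝ) (n : ℕ) : stepLaw m d n 0 = graphLaw m d (n + 1) :=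
  PMF.bind_pure _

theorem stepLaw_succ (m : ℕ) (d : ℕ → ℝ) (n i : ℕ) :
    stepLaw m d n (i + 1) = (stepLaw m d n i).bind (addEdge (n + 2) (d (n + 2))) :=
  (PMF.bind_bind _ _ _).symm

theorem stepLaw_next (m : ℕ) (d : ℕ → ℝ) (n : ℕ) : stepLaw m d (n + 1) 0 = stepLaw m d n m :=
  stepLaw_zero m d (n + 1)

theorem stepLaw_induction (hd : ∀ t, -(m : ℝ) < d t) (n i : ℕ)
    (h0 : (stepLaw m d n 0).support.Finite ∧
      ∀ G ∈ (stepLaw m d n 0).support, IsStage m (n + 2) 0 G) :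
    (stepLaw m d n i).support.Finite ∧
      ∀ G ∈ (stepLaw m d n i).support, IsStage m (n + 2) i G := by
  induction i with
  | zero => exact h0
  | succ i ih =>
    rw [stepLaw_succ]
    refine ⟨finite_support_bind ih.1 fun G hG =>
      addEdge_finite (ih.2 G hG) (by omega) (hd _), fun G hG => ?_⟩
    obtain ⟨G', hG', hG⟩ := (PMF.mem_support_bind_iff _ _ _).1 hG
    exact addEdge_support (ih.2 G' hG') (by omega) (hd _) G hG

theorem stepLaw_support (hd : ∀ t, -(m : ℝ) < d t) (n i : ℕ) :
    (stepLaw m d n i).support.Finite ∧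
      ∀ G ∈ (stepLaw m d n i).support, IsStage m (n + 2) i G := by
  refine stepLaw_induction hd n i ?_
  induction n with
  | zero =>
    rw [stepLaw_zero, graphLaw, PMF.support_pure]
    refine ⟨Set.finite_singleton _, fun G hG => ?_⟩
    rw [Set.mem_singleton_iff.1 hG]
    exact isStage_seed m
  | succ n ih =>
    rw [stepLaw_next]
    obtain ⟨h1, h2⟩ := stepLaw_induction hd n m ih
    exact ⟨h1, fun G hG => (h2 G hG).next⟩

theorem stepLaw_finite (hd : ∀ t, -(m : ℝ) < d t) (n i : ℕ) :
    (stepLaw m d n i).support.Finite := (stepLaw_support hd n i).1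

theorem isStage_of_mem (hd : ∀ t, -(m : ℝ) < d t) {n i : ℕ} {G : Graph}
    (hG : G ∈ (stepLaw m d n i).support) : IsStage m (n + 2) i G := (stepLaw_support hd n i).2 G hG

theorem graphLaw_congr {d' : ℕ → ℝ} {n : ℕ} (h : ∀ t ≤ n, d t = d' t) :
    graphLaw m d n = graphLaw m d' n := by
  induction n using Nat.twoStepInduction with
  | zero => rfl
  | one => rfl
  | more n _ ih =>
    rw [graphLaw, graphLaw, ih fun t ht => h t (by omega), h (n + 2) le_rfl]

/-- The expected sum of `f (D_v)` over the vertices `v < n + 2`, after `i` edges of the vertex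
`n + 2` have been added. -/
def meanSum (m : ℕ) (d : ℕ → ℝ) (f : ℕ → ℝ) (n i : ℕ) : ℝ :=
  expect (stepLaw m d n i) (degSum f (n + 2))

theorem meanSum_add (hd : ∀ t, -(m : ℝ) < d t) (f g : ℕ → ℝ) (n i : ℕ) :
    meanSum m d (fun x => f x + g x) n i = meanSum m d f n i + meanSum m d g n i := by
  rw [meanSum, meanSum, meanSum, ← expect_add (stepLaw_finite hd n i)]
  exact congrArg _ (funext fun G => Finset.sum_add_distrib)

theorem meanSum_const_mul (c : ℝ) (f : ℕ → ℝ) (n i : ℕ) :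
    meanSum m d (fun x => c * f x) n i = c * meanSum m d f n i := by
  rw [meanSum, meanSum, ← expect_const_mul]
  exact congrArg _ (funext fun G => (Finset.mul_sum _ _ _).symm)

theorem meanSum_congr (hd : ∀ t, -(m : ℝ) < d t) {f g : ℕ → ℝ} (h : ∀ x, m ≤ x → f x = g x)
    (n i : ℕ) : meanSum m d f n i = meanSum m d g n i :=
  expect_congr fun _ hG => Finset.sum_congr rfl fun v hv =>
    h _ ((isStage_of_mem hd hG).le_degree v (Finset.mem_range.1 hv))

theorem meanSum_mono (hd : ∀ t, -(m : ℝ) < d t) {f g : ℕ → ℝ} (h : ∀ x, m ≤ x → f x ≤ g x)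
    (n i : ℕ) : meanSum m d f n i ≤ meanSum m d g n i :=
  expect_mono (stepLaw_finite hd n i) fun _ hG => Finset.sum_le_sum fun v hv =>
    h _ ((isStage_of_mem hd hG).le_degree v (Finset.mem_range.1 hv))

theorem meanSum_const (m : ℕ) (d : ℕ → ℝ) (c : ℝ) (n i : ℕ) :
    meanSum m d (fun _ => c) n i = c * ((n : ℝ) + 2) := by
  have : degSum (fun _ => c) (n + 2) = fun _ => c * ((n : ℝ) + 2) := by
    funext G
    simp [degSum, mul_comm]
  rw [meanSum, this, expect_const]

theorem abs_meanSum_le (hd : ∀ t, -(m : ℝ) < d t) {f : ℕ → ℝ} {B : ℝ}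
    (h : ∀ x, m ≤ x → |f x| ≤ B) (n i : ℕ) : |meanSum m d f n i| ≤ B * ((n : ℝ) + 2) := by
  rw [abs_le, ← neg_mul, ← meanSum_const m d, ← meanSum_const m d]
  exact ⟨meanSum_mono hd (fun x hx => (abs_le.1 (h x hx)).1) n i,
    meanSum_mono hd (fun x hx => (abs_le.1 (h x hx)).2) n i⟩

/-- The normalizing constant is deterministic at a given stage, so the mean passes through the
quotient and the evolution is linear. -/
theorem meanSum_succ (hd : ∀ t, -(m : ℝ) < d t) (f : ℕ → ℝ) (n i : ℕ) :
    meanSum m d f n (i + 1) = meanSum m d f n i +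
      meanSum m d (fun x => (f (x + 1) - f x) * (x + d (n + 2))) n i /
        normConst m (n + 2) i (d (n + 2)) := by
  have hfin := stepLaw_finite hd n i
  rw [meanSum, stepLaw_succ, expect_bind hfin fun G hG =>
    addEdge_finite (isStage_of_mem hd hG) (by omega) (hd _),
    expect_congr fun G hG => expect_addEdge (isStage_of_mem hd hG) (by omega) (hd _) f,
    expect_add hfin, meanSum, meanSum]
  simp only [div_eq_inv_mul]
  rw [expect_const_mul]

theorem meanSum_next (hd : ∀ t, -(m : ℝ) < d t) (f : ℕ → ℝ) (n : ℕ) :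
    meanSum m d f (n + 1) 0 = meanSum m d f n m + f m := by
  have hfin := stepLaw_finite hd n m
  rw [meanSum, stepLaw_next, meanSum, ← expect_const (stepLaw m d n m) (f m), ← expect_add hfin]
  refine expect_congr fun G hG => ?_
  rw [degSum, Finset.sum_range_succ, (isStage_of_mem hd hG).degree_self, degSum]

theorem meanSum_zero_congr {d' : ℕ → ℝ} {n : ℕ} (h : ∀ t ≤ n + 1, d t = d' t) (f : ℕ → ℝ) :
    meanSum m d f n 0 = meanSum m d' f n 0 := by
  rw [meanSum, meanSum, stepLaw_zero, stepLaw_zero, graphLaw_congr h]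

theorem meanSum_seq (hd : ∀ t, -(m : ℝ) < d t) (f : ℕ → ℝ) (n : ℕ) :
    meanSum m d f (n + 1) 0 = meanSum m d f n 0 + f m +
      ∑ i ∈ Finset.range m, meanSum m d (fun x => (f (x + 1) - f x) * (x + d (n + 2))) n i /
        normConst m (n + 2) i (d (n + 2)) := by
  rw [meanSum_next hd]
  suffices h : ∀ j, meanSum m d f n j = meanSum m d f n 0 +
      ∑ i ∈ Finset.range j, meanSum m d (fun x => (f (x + 1) - f x) * (x + d (n + 2))) n i /
        normConst m (n + 2) i (d (n + 2)) by
    rw [h m]; ring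
  intro j
  induction j with
  | zero => simp
  | succ j ih => rw [meanSum_succ hd, ih, Finset.sum_range_succ]; ring

/-- The hypothesis is scaled by m + d because the total weight is at least (n + 2) (m + d); `B` is
then a bound per edge. -/
theorem abs_meanSum_sub_zero_le (hd : ∀ t, -(m : ℝ) < d t) {f : ℕ → ℝ} {B : ℝ} {n : ℕ}
    (h : ∀ x : ℕ, m ≤ x → |(f (x + 1) - f x) * (x + d (n + 2))| ≤ B * (m + d (n + 2))) (i : ℕ) :
    |meanSum m d f n i - meanSum m d f n 0| ≤ B * i := by
  induction i with
  | zero => simp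
  | succ i ih =>
    have hS := normConst_pos (m := m) (t := n + 2) (by omega) i (hd (n + 2))
    have hstep : |meanSum m d f n (i + 1) - meanSum m d f n i| ≤ B := by
      have hB : 0 ≤ B :=
        nonneg_of_mul_nonneg_left ((abs_nonneg _).trans (h m le_rfl)) (by linarith [hd (n + 2)])
      rw [meanSum_succ hd, add_sub_cancel_left, abs_div, abs_of_pos hS, div_le_iff₀ hS]
      refine (abs_meanSum_le hd h n i).trans ?_
      have := mul_le_mul_of_nonneg_left
        (le_normConst (m := m) (t := n + 2) (by omega) i (d (n + 2))) hB
      push_cast at this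
      linarith
    calc _ ≤ |meanSum m d f n (i + 1) - meanSum m d f n i| +
          |meanSum m d f n i - meanSum m d f n 0| := abs_sub_le _ _ _
      _ ≤ B + B * i := add_le_add hstep ih
      _ = _ := by push_cast; ring

theorem abs_meanSum_next_sub_le (hd : ∀ t, -(m : ℝ) < d t) {f : ℕ → ℝ} {B : ℝ} {n : ℕ}
    (h : ∀ x : ℕ, m ≤ x → |(f (x + 1) - f x) * (x + d (n + 2))| ≤ B * (m + d (n + 2))) :
    |meanSum m d f (n + 1) 0 - meanSum m d f n 0| ≤ B * m + |f m| := by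
  rw [meanSum_next hd, add_sub_right_comm]
  exact (abs_add_le _ _).trans (by gcongr; exact abs_meanSum_sub_zero_le hd h m)

end StepLaw

/-! ### The score as a degree sum -/

/-- The function of the degree whose sum over all vertices is the random part of the score. -/
def scoreWeight (m : ℕ) (δ : ℝ) (k : ℕ) : ℝ :=
  ∑ j ∈ Finset.range (k - m), 1 / (((m + j : ℕ) : ℝ) + δ)

theorem scoreWeight_succ {m k : ℕ} (δ : ℝ) (hk : m ≤ k) :
    scoreWeight m δ (k + 1) - scoreWeight m δ k = 1 / ((k : ℝ) + δ) := by
  rw [scoreWeight, Nat.succ_sub hk, Finset.sum_range_succ, scoreWeight, add_sub_cancel_left,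
    Nat.add_sub_cancel' hk]

/-- Interchange of sums: a vertex of degree D is counted in N_{>k} exactly for k < D. -/
theorem tsum_numDegGT (m n : ℕ) (δ : ℝ) (G : Graph) :
    ∑' j : ℕ, 1 / (((m + j : ℕ) : ℝ) + δ) * numDegGT n (m + j) G =
      degSum (scoreWeight m δ) (n + 1) G := by
  have hcard : ∀ v, degree G v ≤ G.card := fun v => Multiset.countP_le_card _ _
  rw [tsum_eq_sum (s := Finset.range G.card)]
  · simp only [numDegGT, Finset.card_filter, Nat.cast_sum, Finset.mul_sum]
    rw [Finset.sum_comm, degSum]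
    refine Finset.sum_congr rfl fun v _ => ?_
    simp only [Nat.cast_ite, Nat.cast_one, Nat.cast_zero, mul_ite, mul_one, mul_zero]
    rw [← Finset.sum_filter, scoreWeight]
    refine Finset.sum_congr ?_ fun _ _ => rfl
    ext j
    have := hcard v
    simp only [Finset.mem_filter, Finset.mem_range]
    omega
  · intro j hj
    rw [Finset.mem_range, not_lt] at hj
    rw [numDegGT_eq_zero n (m + j) G (by omega)]
    simp

theorem expect_score {m : ℕ} {d : ℕ → ℝ} (hd : ∀ t, -(m : ℝ) < d t) (n : ℕ) (δ : ℝ) :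
    (((n + 1 : ℕ) : ℝ) + 1) * expect (graphLaw m d (n + 1)) (score m (n + 1) δ) =
      meanSum m d (scoreWeight m δ) n 0 -
        ∑ t ∈ Finset.Icc 2 (n + 1), ∑ i ∈ Finset.range m, (t : ℝ) / normConst m t i δ := by
  have hne : (((n + 1 : ℕ) : ℝ) + 1) ≠ 0 := by positivity
  have hs : score m (n + 1) δ = fun G => 1 / (((n + 1 : ℕ) : ℝ) + 1) *
      degSum (scoreWeight m δ) (n + 2) G + -(1 / (((n + 1 : ℕ) : ℝ) + 1) *
        ∑ t ∈ Finset.Icc 2 (n + 1), ∑ i ∈ Finset.range m, (t : ℝ) / normConst m t i δ) := by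
    funext G
    rw [score, tsum_numDegGT, sub_eq_add_neg]
  rw [← stepLaw_zero, hs, expect_add (stepLaw_finite hd n 0), expect_const_mul, expect_const,
    meanSum]
  field_simp
  ring

/-! ### Linear recursions and limiting degrees of the null model -/

/-- A sequence with `x (n + 1) = (1 - b / (n + 2)) * x n + o(1)` is `o(n)`. -/
theorem tendsto_div_zero_of_recursion {x e : ℕ → ℝ} {b : ℝ} (hb : 0 ≤ b)
    (hx : ∀ n : ℕ, x (n + 1) = (1 - b / ((n : ℝ) + 2)) * x n + e n)
    (he : Tendsto e atTop (𝓝 0)) :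
    Tendsto (fun n : ℕ => x n / ((n : ℝ) + 2)) atTop (𝓝 0) := by
  -- From N ≥ b on the factor lies in [0, 1], so |x| grows by at most |e|, and Cesàro averaging
  -- finishes.
  obtain ⟨N, hN⟩ := exists_nat_ge b
  have hstep : ∀ n, N ≤ n → |x (n + 1)| ≤ |x n| + |e n| := by
    intro n hn
    have hn' : (N : ℝ) ≤ n := by exact_mod_cast hn
    have hpos : (0 : ℝ) < n + 2 := by positivity
    have h1 : b / ((n : ℝ) + 2) ≤ 1 := (div_le_one hpos).2 (by linarith)
    have h2 : 0 ≤ b / ((n : ℝ) + 2) := by positivity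
    rw [hx]
    refine (abs_add_le _ _).trans (add_le_add ?_ le_rfl)
    rw [abs_mul]
    exact mul_le_of_le_one_left (abs_nonneg _) (abs_le.2 ⟨by linarith, by linarith⟩)
  have hsum : ∀ k, |x (k + N)| ≤ |x N| + ∑ i ∈ Finset.range k, |e (i + N)| := by
    intro k
    induction k with
    | zero => simp
    | succ k ih =>
      rw [Finset.sum_range_succ, Nat.succ_add]
      linarith [hstep (k + N) (by omega)]
  rw [← tendsto_add_atTop_iff_nat N]
  have hces : Tendsto (fun k : ℕ => (k : ℝ)⁻¹ * |x N| +
      (k : ℝ)⁻¹ * ∑ i ∈ Finset.range k, |e (i + N)|) atTop (𝓝 0) := by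
    have h1 : Tendsto (fun k : ℕ => (k : ℝ)⁻¹ * |x N|) atTop (𝓝 0) := by
      simpa using (tendsto_inv_atTop_nhds_zero_nat (𝕜 := ℝ)).mul_const |x N|
    have h2 : Tendsto (fun i => |e (i + N)|) atTop (𝓝 0) := by
      simpa using ((tendsto_add_atTop_iff_nat N).2 he).abs
    simpa using h1.add h2.cesaro
  refine squeeze_zero_norm' ?_ hces
  filter_upwards [eventually_gt_atTop 0] with k hk
  have hk' : (0 : ℝ) < k := by exact_mod_cast hk
  rw [Real.norm_eq_abs, abs_div, ← mul_add, div_eq_inv_mul]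
  have hle : (k : ℝ) ≤ |((k + N : ℕ) : ℝ) + 2| := by
    rw [abs_of_pos (by positivity)]
    push_cast
    linarith [(Nat.cast_nonneg N : (0 : ℝ) ≤ N)]
  exact mul_le_mul (inv_anti₀ hk' hle) (hsum k) (abs_nonneg _) (by positivity)

/-- The linear sequence e₀ / (1 + b) * (n + 2) solves the recursion with constant source e₀;
subtracting it reduces to e₀ = 0. -/
theorem tendsto_div_of_recursion {x e : ℕ → ℝ} {b e₀ : ℝ} (hb : 0 ≤ b)
    (hx : ∀ n : ℕ, x (n + 1) = (1 - b / ((n : ℝ) + 2)) * x n + e n)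
    (he : Tendsto e atTop (𝓝 e₀)) :
    Tendsto (fun n : ℕ => x n / ((n : ℝ) + 2)) atTop (𝓝 (e₀ / (1 + b))) := by
  have hb1 : 1 + b ≠ 0 := by positivity
  have h := tendsto_div_zero_of_recursion (x := fun n => x n - e₀ / (1 + b) * ((n : ℝ) + 2))
    (e := fun n => e n - e₀) hb (fun n => by
      have hpos : (n : ℝ) + 2 ≠ 0 := by positivity
      rw [hx]
      push_cast
      field_simp
      ring) (by simpa using he.sub_const e₀)
  have h' := h.add_const (e₀ / (1 + b))
  rw [zero_add] at h'
  refine h'.congr fun n => ?_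
  have hpos : (n : ℝ) + 2 ≠ 0 := by positivity
  field_simp
  ring

theorem tendsto_const_div_add_two (C : ℝ) :
    Tendsto (fun n : ℕ => C / ((n : ℝ) + 2)) atTop (𝓝 0) :=
  Tendsto.const_div_atTop (tendsto_natCast_atTop_atTop.atTop_add tendsto_const_nhds) C

theorem tendsto_div_normConst {m : ℕ} {a : ℝ} (hm : 1 ≤ m) (ha : -(m : ℝ) < a) (i : ℕ) :
    Tendsto (fun n : ℕ => ((n : ℝ) + 2) / normConst m (n + 2) i a) atTop
      (𝓝 (1 / (2 * m + a))) := by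
  have hm' : (1 : ℝ) ≤ m := by exact_mod_cast hm
  have hpos : (2 * m + a : ℝ) ≠ 0 := by linarith
  have h : Tendsto (fun n : ℕ => 1 / ((2 * m + a) + (i - 2 * m : ℝ) / ((n : ℝ) + 2))) atTop
      (𝓝 (1 / (2 * m + a + 0))) :=
    tendsto_const_nhds.div (tendsto_const_nhds.add (tendsto_const_div_add_two _)) (by simpa)
  rw [add_zero] at h
  refine h.congr fun n => ?_
  have hn : (n : ℝ) + 2 ≠ 0 := by positivity
  have hS : normConst m (n + 2) i a = ((2 * m + a) + (i - 2 * m : ℝ) / ((n : ℝ) + 2)) *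
      ((n : ℝ) + 2) := by
    rw [normConst]
    push_cast
    field_simp
    ring
  rw [hS, div_mul_cancel_right₀ hn, one_div]

/-- The indicator of the degrees that are at least `k`. -/
def geInd (k x : ℕ) : ℝ := if k ≤ x then 1 else 0

theorem geInd_nonneg (k x : ℕ) : 0 ≤ geInd k x := by
  unfold geInd; split_ifs <;> norm_num

theorem geInd_le_one (k x : ℕ) : geInd k x ≤ 1 := by
  unfold geInd; split_ifs <;> norm_num

/-- The indicator jumps only at x = k, where the weight is k + a, and [x = k] is a difference of
tail indicators. Hence the mean tail counts form a closed triangular system. -/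
theorem geInd_succ_sub (k x : ℕ) (a : ℝ) :
    (geInd (k + 1) (x + 1) - geInd (k + 1) x) * (x + a) =
      (k + a) * geInd k x + -(k + a) * geInd (k + 1) x := by
  unfold geInd
  rcases lt_trichotomy x k with h | rfl | h
  · rw [if_neg (by omega), if_neg (by omega), if_neg (by omega)]; ring
  · rw [if_pos (by omega), if_neg (by omega), if_pos (by omega)]; ring
  · rw [if_pos (by omega), if_pos (by omega), if_pos (by omega)]; ring

section Null

variable {m : ℕ} {d : ℕ → ℝ}

theorem tendsto_meanSum_sub_zero (hd : ∀ t, -(m : ℝ) < d t) {f : ℕ → ℝ} {B : ℝ}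
    (h : ∀ (n x : ℕ), m ≤ x → |(f (x + 1) - f x) * (x + d (n + 2))| ≤ B * (m + d (n + 2)))
    (i : ℕ) :
    Tendsto (fun n : ℕ => meanSum m d f n i / ((n : ℝ) + 2) - meanSum m d f n 0 / ((n : ℝ) + 2))
      atTop (𝓝 0) := by
  refine squeeze_zero_norm (fun n => ?_) (tendsto_const_div_add_two (B * i))
  have hn : (0 : ℝ) < (n : ℝ) + 2 := by positivity
  rw [← sub_div, norm_div, Real.norm_eq_abs, Real.norm_of_nonneg hn.le]
  exact div_le_div_of_nonneg_right (abs_meanSum_sub_zero_le hd (h n) i) hn.le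

/-- The limiting proportion of vertices of degree at least `m + j`. -/
def tailDist (m : ℕ) (a : ℝ) : ℕ → ℝ
  | 0 => 1
  | j + 1 => (m + j + a) / (m + j + a + (2 + a / m)) * tailDist m a j

variable {a : ℝ}

theorem geInd_lipschitz (ha : -(m : ℝ) < a) (j : ℕ) (n x : ℕ) (hx : m ≤ x) :
    |(geInd (m + j) (x + 1) - geInd (m + j) x) * (x + nullParam a (n + 2))| ≤
      ((m + j + a) / (m + a)) * (m + nullParam a (n + 2)) := by
  have hma : 0 < m + a := by linarith
  have hj : (0 : ℝ) ≤ j := Nat.cast_nonneg j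
  simp only [nullParam]
  rw [div_mul_cancel₀ _ hma.ne']
  have hx' : (m : ℝ) ≤ x := by exact_mod_cast hx
  unfold geInd
  by_cases h : x + 1 = m + j
  · have h' : (x : ℝ) + 1 = m + j := by exact_mod_cast h
    rw [if_pos (by omega), if_neg (by omega), sub_zero, one_mul, abs_of_nonneg (by linarith)]
    linarith
  · have : (if m + j ≤ x + 1 then (1 : ℝ) else 0) = if m + j ≤ x then 1 else 0 := by
      congr 1
      exact propext (by omega)
    rw [this, sub_self, zero_mul, abs_zero]
    linarith

theorem tendsto_tail (hm : 1 ≤ m) (ha : -(m : ℝ) < a) (j : ℕ) :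
    Tendsto (fun n : ℕ => meanSum m (nullParam a) (geInd (m + j)) n 0 / ((n : ℝ) + 2)) atTop
      (𝓝 (tailDist m a j)) := by
  have hd : ∀ t, -(m : ℝ) < nullParam a t := fun _ => ha
  have hm' : (1 : ℝ) ≤ m := by exact_mod_cast hm
  induction j with
  | zero =>
    refine tendsto_const_nhds.congr fun n => ?_
    have hn : (n : ℝ) + 2 ≠ 0 := by positivity
    rw [meanSum_congr hd (f := geInd (m + 0)) (g := fun _ => 1) (fun x hx => if_pos hx), meanSum_const, one_mul,
      div_self hn, tailDist]
  | succ j ih =>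
    have hpos : 0 < 2 * m + a := by linarith
    have hj : (0 : ℝ) ≤ j := Nat.cast_nonneg j
    have hw : 0 < m + j + a := by linarith
    set β : ℝ := (m + j + a) / (2 * m + a) with hβ
    have hb : 0 ≤ m * β := by positivity
    set H : ℕ → ℕ → ℕ → ℝ := fun k n i => meanSum m (nullParam a) (geInd (m + k)) n i with hH
    -- The increment of edge `i` with its asymptotic damping β H(j + 1) / (n + 2) added back, so
    -- that the limit of the source involves the tail `j` only.
    set T : ℕ → ℕ → ℝ := fun i n =>
      (m + j + a) * (H j n i - H (j + 1) n i) / normConst m (n + 2) i a +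
        β * (H (j + 1) n 0 / ((n : ℝ) + 2)) with hT
    have hrec : ∀ n : ℕ, H (j + 1) (n + 1) 0 = (1 - m * β / ((n : ℝ) + 2)) * H (j + 1) n 0 +
        ∑ i ∈ Finset.range m, T i n := by
      intro n
      have h1 : ∀ i, meanSum m (nullParam a)
          (fun x => (geInd (m + (j + 1)) (x + 1) - geInd (m + (j + 1)) x) *
            (x + nullParam a (n + 2))) n i = (m + j + a) * (H j n i - H (j + 1) n i) := by
        intro i
        simp only [nullParam, ← add_assoc, geInd_succ_sub]
        rw [meanSum_add hd, meanSum_const_mul, meanSum_const_mul]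
        simp only [hH, ← add_assoc]
        push_cast
        ring
      simp only [hH]
      rw [meanSum_seq hd]
      simp only [h1]
      simp only [hT, Finset.sum_add_distrib, Finset.sum_const, Finset.card_range, nsmul_eq_mul]
      rw [geInd, if_neg (by omega)]
      simp only [nullParam, hH]
      ring
    have hT0 : ∀ i, Tendsto (T i) atTop (𝓝 (β * tailDist m a j)) := by
      intro i
      have hq := tendsto_div_normConst hm ha i
      have h1 := (tendsto_meanSum_sub_zero hd (geInd_lipschitz ha j) i).add ih
      have h2 := tendsto_meanSum_sub_zero hd (geInd_lipschitz ha (j + 1)) i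
      -- The limit of H(j + 1) / (n + 2) is still unknown; that it is at most 1 suffices, since its
      -- coefficient tends to 0.
      have h3 : Tendsto (fun n : ℕ => (((n : ℝ) + 2) / normConst m (n + 2) i a -
          1 / (2 * m + a)) * (H (j + 1) n 0 / ((n : ℝ) + 2))) atTop (𝓝 0) := by
        have hq' := hq.sub_const (1 / (2 * m + a))
        rw [sub_self] at hq'
        refine squeeze_zero_norm (fun n => ?_) (by simpa only [abs_zero] using hq'.abs)
        rw [norm_mul, Real.norm_eq_abs]
        refine mul_le_of_le_one_right (abs_nonneg _) ?_
        have hn : (0 : ℝ) < (n : ℝ) + 2 := by positivity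
        rw [norm_div, Real.norm_of_nonneg hn.le, div_le_one hn]
        refine (abs_meanSum_le hd (B := 1) (fun x _ => ?_) n 0).trans_eq (one_mul _)
        rw [abs_of_nonneg (geInd_nonneg _ _)]
        exact geInd_le_one _ _
      have h4 := (((hq.mul h1).sub (hq.mul h2)).sub h3).const_mul (m + j + a)
      have hlim : (m + j + a : ℝ) * (1 / (2 * m + a) * (0 + tailDist m a j) -
          1 / (2 * m + a) * 0 - 0) = β * tailDist m a j := by
        rw [hβ]; ring
      rw [hlim] at h4
      refine h4.congr fun n => ?_
      have hn : (n : ℝ) + 2 ≠ 0 := by positivity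
      have hS := (normConst_pos (m := m) (t := n + 2) (by omega) i ha).ne'
      simp only [hT, hβ, hH]
      field_simp
      ring
    have hsum : Tendsto (fun n => ∑ i ∈ Finset.range m, T i n) atTop
        (𝓝 (m * (β * tailDist m a j))) := by
      simpa using tendsto_finsetSum (Finset.range m) fun i _ => hT0 i
    have hlim : m * (β * tailDist m a j) / (1 + m * β) = tailDist m a (j + 1) := by
      have h1 : -1 < a / m := by rw [lt_div_iff₀ (by linarith)]; linarith
      have h2 : 0 < m + j + a + (2 + a / m) := by linarith
      have h3 : 0 < 1 + m * β := by linarith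
      have h4 : (2 + a / m) * m = 2 * m + a := by field_simp
      have h5 : β * (2 * m + a) = m + j + a := div_mul_cancel₀ _ hpos.ne'
      have h6 : (m + j + a) / (m + j + a + (2 + a / m)) * (m + j + a + (2 + a / m)) =
          (m + j + a : ℝ) := div_mul_cancel₀ _ h2.ne'
      have hθ : (2 + a / m : ℝ) ≠ 0 := by linarith
      rw [tailDist, div_eq_iff h3.ne']
      generalize (m + j + a : ℝ) / (m + j + a + (2 + a / m)) = r at h6 ⊢
      rw [← h4] at h5
      refine mul_right_cancel₀ hθ ?_
      linear_combination (tailDist m a j - r * tailDist m a j) * h5 - tailDist m a j * h6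
    rw [← hlim]
    exact tendsto_div_of_recursion hb hrec hsum

end Null

/-! ### The limiting degree distribution -/

section TailDist

variable {m : ℕ} {a : ℝ}

theorem tailDist_succ_mul (hm : 1 ≤ m) (ha : -(m : ℝ) < a) (j : ℕ) :
    tailDist m a (j + 1) * (m + j + a + (2 + a / m)) = (m + j + a) * tailDist m a j := by
  have hm' : (0 : ℝ) < m := by exact_mod_cast hm
  have hj : (0 : ℝ) ≤ j := Nat.cast_nonneg j
  have h1 : -1 < a / m := by rw [lt_div_iff₀ hm']; linarith
  have h2 : (m + j + a + (2 + a / m) : ℝ) ≠ 0 := by linarith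
  rw [tailDist, div_mul_eq_mul_div, div_mul_cancel₀ _ h2]

theorem tailDist_pos (hm : 1 ≤ m) (ha : -(m : ℝ) < a) (j : ℕ) : 0 < tailDist m a j := by
  have hm' : (0 : ℝ) < m := by exact_mod_cast hm
  have h1 : -1 < a / m := by rw [lt_div_iff₀ hm']; linarith
  induction j with
  | zero => simp [tailDist]
  | succ j ih =>
    have hj : (0 : ℝ) ≤ j := Nat.cast_nonneg j
    rw [tailDist]
    exact mul_pos (div_pos (by linarith) (by linarith)) ih

/-- By Γ(x + 1) = x Γ(x), passing from j to j + 1 multiplies both sides by (m + j + a) / (m + j + 3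
+ a + a/m). -/
theorem degDist_add (hm : 1 ≤ m) (ha : -(m : ℝ) < a) (j : ℕ) :
    degDist m a (m + j) = (2 + a / m) / (m + j + a + (2 + a / m)) * tailDist m a j := by
  have hm' : (0 : ℝ) < m := by exact_mod_cast hm
  have h1 : -1 < a / m := by rw [lt_div_iff₀ hm']; linarith
  have hΓ : 0 < Real.Gamma (m + a) := Real.Gamma_pos_of_pos (by linarith)
  induction j with
  | zero =>
    have hΓ2 : 0 < Real.Gamma (m + 2 + a + a / m) := Real.Gamma_pos_of_pos (by linarith)
    have h3 : (m : ℝ) + 3 + a + a / m = (m + 2 + a + a / m) + 1 := by ring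
    have h2 : (m + 2 + a + a / m : ℝ) ≠ 0 := by linarith
    rw [degDist, add_zero, h3, Real.Gamma_add_one h2, tailDist]
    have h4 : (m + ((0 : ℕ) : ℝ) + a + (2 + a / m) : ℝ) = m + 2 + a + a / m := by
      push_cast; ring
    rw [h4]
    generalize (a / m : ℝ) = c at *
    field_simp
  | succ j ih =>
    have hj : (0 : ℝ) ≤ j := Nat.cast_nonneg j
    have h2 : (m + j + a : ℝ) ≠ 0 := by linarith
    have h3 : (m + j + 3 + a + a / m : ℝ) ≠ 0 := by linarith
    have hΓ2 : 0 < Real.Gamma (m + j + 3 + a + a / m) := Real.Gamma_pos_of_pos (by linarith)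
    have e1 : ((m + (j + 1) : ℕ) : ℝ) + a = (m + j + a) + 1 := by push_cast; ring
    have e2 : ((m + (j + 1) : ℕ) : ℝ) + 3 + a + a / m = (m + j + 3 + a + a / m) + 1 := by
      push_cast; ring
    have hstep : degDist m a (m + (j + 1)) =
        degDist m a (m + j) * ((m + j + a) / (m + j + 3 + a + a / m)) := by
      rw [degDist, degDist, e1, e2, Real.Gamma_add_one h2, Real.Gamma_add_one h3]
      push_cast
      field_simp
    have h4 : (m + j + a + (2 + a / m) : ℝ) ≠ 0 := by linarith
    have h5 : (m + ((j + 1 : ℕ) : ℝ) + a + (2 + a / m) : ℝ) = m + j + 3 + a + a / m := by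
      push_cast; ring
    rw [hstep, ih, tailDist, h5]
    field_simp

theorem degDist_eq_sub (hm : 1 ≤ m) (ha : -(m : ℝ) < a) (j : ℕ) :
    degDist m a (m + j) = tailDist m a j - tailDist m a (j + 1) := by
  have hm' : (0 : ℝ) < m := by exact_mod_cast hm
  have hj : (0 : ℝ) ≤ j := Nat.cast_nonneg j
  have h1 : -1 < a / m := by rw [lt_div_iff₀ hm']; linarith
  have h2 : (m + j + a + (2 + a / m) : ℝ) ≠ 0 := by linarith
  rw [degDist_add hm ha, tailDist, div_mul_eq_mul_div, div_mul_eq_mul_div, eq_sub_iff_add_eq,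
    ← add_div, div_eq_iff h2]
  ring

theorem degDist_pos (hm : 1 ≤ m) (ha : -(m : ℝ) < a) (j : ℕ) : 0 < degDist m a (m + j) := by
  have hm' : (0 : ℝ) < m := by exact_mod_cast hm
  have hj : (0 : ℝ) ≤ j := Nat.cast_nonneg j
  have h1 : -1 < a / m := by rw [lt_div_iff₀ hm']; linarith
  rw [degDist_add hm ha]
  exact mul_pos (div_pos (by linarith) (by linarith)) (tailDist_pos hm ha j)

/-- With w_j = m + j + a and tails q_j, the recursion reads (1 + a/m) q_{j+1} = w_j q_j - w_{j+1}
q_{j+1}, and the sum telescopes. This yields both q_j → 0 and the bound 2m on the mean degree. -/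
theorem sum_tailDist_le (hm : 1 ≤ m) (ha : -(m : ℝ) < a) (J : ℕ) :
    ∑ j ∈ Finset.range J, tailDist m a (j + 1) ≤ m := by
  have hm' : (0 : ℝ) < m := by exact_mod_cast hm
  have hma : 0 < m + a := by linarith
  have key : (m + a) / m * ∑ j ∈ Finset.range J, tailDist m a (j + 1) =
      (m + a) - (m + J + a) * tailDist m a J := by
    induction J with
    | zero => simp [tailDist]
    | succ J ih =>
      have h := tailDist_succ_mul hm ha J
      have e : (m + a) / (m : ℝ) = 1 + a / m := by field_simp
      rw [Finset.sum_range_succ, mul_add, ih, e]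
      push_cast
      linarith
  have hJ : 0 ≤ (m + J + a) * tailDist m a J :=
    mul_nonneg (by linarith [(Nat.cast_nonneg J : (0 : ℝ) ≤ J)]) (tailDist_pos hm ha J).le
  have h3 : (m + a) / m * ∑ j ∈ Finset.range J, tailDist m a (j + 1) ≤ (m + a) / m * m := by
    rw [key, div_mul_cancel₀ _ hm'.ne']
    linarith
  exact le_of_mul_le_mul_left h3 (by positivity)

theorem tendsto_tailDist (hm : 1 ≤ m) (ha : -(m : ℝ) < a) :
    Tendsto (tailDist m a) atTop (𝓝 0) := by
  rw [← tendsto_add_atTop_iff_nat 1]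
  exact (summable_of_sum_range_le (fun j => (tailDist_pos hm ha (j + 1)).le)
    (sum_tailDist_le hm ha)).tendsto_atTop_zero

theorem hasSum_degDist (hm : 1 ≤ m) (ha : -(m : ℝ) < a) :
    HasSum (fun j => degDist m a (m + j)) 1 := by
  rw [hasSum_iff_tendsto_nat_of_nonneg fun j => (degDist_pos hm ha j).le]
  simp only [degDist_eq_sub hm ha, Finset.sum_range_sub']
  simpa [tailDist] using (tendsto_tailDist hm ha).const_sub (tailDist m a 0)

/-- Summation by parts, with p = q_j - q_{j+1}. -/
theorem sum_mul_degDist_le (hm : 1 ≤ m) (ha : -(m : ℝ) < a) (J : ℕ) :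
    ∑ j ∈ Finset.range J, (j : ℝ) * degDist m a (m + j) ≤ m := by
  have key : ∑ j ∈ Finset.range J, (j : ℝ) * degDist m a (m + j) =
      ∑ j ∈ Finset.range J, tailDist m a (j + 1) - J * tailDist m a J := by
    induction J with
    | zero => simp
    | succ J ih =>
      rw [Finset.sum_range_succ, ih, Finset.sum_range_succ, degDist_eq_sub hm ha]
      push_cast
      ring
  rw [key]
  have := mul_nonneg (Nat.cast_nonneg J : (0 : ℝ) ≤ J) (tailDist_pos hm ha J).le
  linarith [sum_tailDist_le hm ha J]

/-- The limit of the average of `1 / (D_v + δ)` over the vertices. -/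
def meanInv (m : ℕ) (a δ : ℝ) : ℝ := ∑' j : ℕ, degDist m a (m + j) / (m + j + δ)

variable {δ : ℝ}

theorem summable_meanInv (hm : 1 ≤ m) (ha : -(m : ℝ) < a) (hδ : -(m : ℝ) < δ) :
    Summable fun j : ℕ => degDist m a (m + j) / (m + j + δ) := by
  refine Summable.of_nonneg_of_le (fun j => ?_) (fun j => ?_)
    ((hasSum_degDist hm ha).summable.div_const (m + δ))
  all_goals
    have hj : (0 : ℝ) ≤ j := Nat.cast_nonneg j
  · exact div_nonneg (degDist_pos hm ha j).le (by linarith)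
  · exact div_le_div_of_nonneg_left (degDist_pos hm ha j).le (by linarith) (by linarith)

theorem kappaTerm_eq (m : ℕ) (a δ : ℝ) :
    kappaTerm m a δ = fun j : ℕ => (2 * m + δ) * (degDist m a (m + j) / (m + j + δ)) := by
  funext j
  rw [kappaTerm]
  push_cast
  ring

theorem summable_kappaTerm (hm : 1 ≤ m) (ha : -(m : ℝ) < a) (hδ : -(m : ℝ) < δ) :
    Summable (kappaTerm m a δ) := by
  rw [kappaTerm_eq]
  exact (summable_meanInv hm ha hδ).mul_left _

theorem tsum_kappaTerm (m : ℕ) (a δ : ℝ) :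
    ∑' j, kappaTerm m a δ j = (2 * m + δ) * meanInv m a δ := by
  rw [kappaTerm_eq, tsum_mul_left, meanInv]

theorem meanInv_nonneg (hm : 1 ≤ m) (ha : -(m : ℝ) < a) (hδ : -(m : ℝ) < δ) :
    0 ≤ meanInv m a δ := by
  refine tsum_nonneg fun j => div_nonneg (degDist_pos hm ha j).le ?_
  linarith [(Nat.cast_nonneg j : (0 : ℝ) ≤ j)]

theorem meanInv_le (hm : 1 ≤ m) (ha : -(m : ℝ) < a) (hδ : -(m : ℝ) < δ) :
    meanInv m a δ ≤ 1 / (m + δ) := by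
  have h := (hasSum_degDist hm ha).div_const (m + δ)
  refine ((summable_meanInv hm ha hδ).tsum_le_tsum (fun j => ?_) h.summable).trans_eq h.tsum_eq
  have hj : (0 : ℝ) ≤ j := Nat.cast_nonneg j
  exact div_le_div_of_nonneg_left (degDist_pos hm ha j).le (by linarith) (by linarith)

/-- A strict form of Jensen's inequality for `x ↦ 1 / (x + δ)` and the limiting degrees, whose
mean is at most `2 * m`. -/
theorem jensen_kappaTerm (hm : 1 ≤ m) (ha : -(m : ℝ) < a) (hδ : -(m : ℝ) < δ) :
    1 + m ^ 2 / ((m + δ) * (2 * m + δ)) * degDist m a m ≤ ∑' j, kappaTerm m a δ j := by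
  have hm' : (0 : ℝ) < m := by exact_mod_cast hm
  have hp := hasSum_degDist hm ha
  have hjp : Summable fun j : ℕ => (j : ℝ) * degDist m a (m + j) :=
    summable_of_sum_range_le
      (fun j => mul_nonneg (Nat.cast_nonneg j) (degDist_pos hm ha j).le)
      (sum_mul_degDist_le hm ha)
  have hjp_le : ∑' j : ℕ, (j : ℝ) * degDist m a (m + j) ≤ m :=
    Real.tsum_le_of_sum_range_le
      (fun j => mul_nonneg (Nat.cast_nonneg j) (degDist_pos hm ha j).le)
      (sum_mul_degDist_le hm ha)
  have h2 : 0 < 2 * m + δ := by linarith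
  have h1 : 0 < m + δ := by linarith
  -- The Jensen remainder of the single term j = 0; keeping it makes the inequality strict.
  set C : ℝ := m ^ 2 / ((m + δ) * (2 * m + δ)) * degDist m a m
  have hsingle : HasSum (fun j : ℕ => if j = 0 then C else 0) C := hasSum_ite_eq 0 C
  have hlow := ((hp.mul_left (1 + m / (2 * m + δ))).sub
    (hjp.hasSum.mul_left (1 / (2 * m + δ)))).add hsingle
  refine le_trans ?_ (hlow.summable.tsum_le_tsum (fun j => ?_) (summable_kappaTerm hm ha hδ))
  · rw [hlow.tsum_eq]
    have : 1 / (2 * m + δ) * ∑' j : ℕ, (j : ℝ) * degDist m a (m + j) ≤ 1 / (2 * m + δ) * m :=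
      mul_le_mul_of_nonneg_left hjp_le (by positivity)
    have e : 1 / (2 * m + δ) * (m : ℝ) = m / (2 * m + δ) := by ring
    linarith
  · have hj : (0 : ℝ) ≤ j := Nat.cast_nonneg j
    have h3 : 0 < m + j + δ := by linarith
    have hpj := degDist_pos hm ha j
    -- Exact expansion of (2m + δ) / (k + δ) around k = 2m: tangent line plus a nonnegative
    -- quadratic remainder.
    have hk : kappaTerm m a δ j = (1 + m / (2 * m + δ)) * degDist m a (m + j) -
        1 / (2 * m + δ) * (j * degDist m a (m + j)) +
        (j - m : ℝ) ^ 2 / ((m + j + δ) * (2 * m + δ)) * degDist m a (m + j) := by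
      rw [kappaTerm]
      push_cast
      field_simp
      ring
    rw [hk]
    refine add_le_add le_rfl ?_
    split_ifs with hj0
    · subst hj0
      simp [C]
    · positivity

end TailDist

theorem meanSum_sub {m : ℕ} {d : ℕ → ℝ} (hd : ∀ t, -(m : ℝ) < d t) (f g : ℕ → ℝ) (n i : ℕ) :
    meanSum m d (fun x => f x - g x) n i = meanSum m d f n i - meanSum m d g n i := by
  have h := meanSum_add hd f (fun x => -1 * g x) n i
  rw [meanSum_const_mul] at h
  simpa [sub_eq_add_neg] using h

theorem meanSum_sum {m : ℕ} {d : ℕ → ℝ} (hd : ∀ t, -(m : ℝ) < d t) (f : ℕ → ℕ → ℝ) (J n i : ℕ) :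
    meanSum m d (fun x => ∑ j ∈ Finset.range J, f j x) n i =
      ∑ j ∈ Finset.range J, meanSum m d (f j) n i := by
  induction J with
  | zero => simpa using meanSum_const m d 0 n i
  | succ J ih => simp only [Finset.sum_range_succ, meanSum_add hd, ih]

/-! ### Uniform convergence of the average of 1 / (D_v + δ) -/

section Truncation

variable {m : ℕ} {a δ : ℝ}

/-- The truncated sum equals 1 / (x + δ) for x < m + J and 0 otherwise. -/
theorem abs_inv_sub_truncation_le (hδ : -(m : ℝ) < δ) (J : ℕ) {x : ℕ} (hx : m ≤ x) :
    |1 / ((x : ℝ) + δ) - ∑ j ∈ Finset.range J,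
      1 / ((m : ℝ) + j + δ) * (geInd (m + j) x - geInd (m + (j + 1)) x)| ≤
        1 / ((m : ℝ) + J + δ) := by
  obtain ⟨k, rfl⟩ := Nat.exists_eq_add_of_le hx
  have hk0 : (0 : ℝ) ≤ k := Nat.cast_nonneg k
  have hJ0 : (0 : ℝ) ≤ J := Nat.cast_nonneg J
  have hterm : ∀ j, 1 / ((m : ℝ) + j + δ) * (geInd (m + j) (m + k) - geInd (m + (j + 1)) (m + k)) =
      if k = j then 1 / ((m : ℝ) + k + δ) else 0 := by
    intro j
    unfold geInd
    rcases lt_trichotomy j k with h | rfl | h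
    · rw [if_pos (by omega), if_pos (by omega), if_neg (by omega)]; ring
    · rw [if_pos (by omega), if_neg (by omega), if_pos rfl]; ring
    · rw [if_neg (by omega), if_neg (by omega), if_neg (by omega)]; ring
  simp only [hterm]
  rw [Finset.sum_ite_eq]
  push_cast
  split_ifs with h
  · rw [sub_self, abs_zero]
    exact one_div_nonneg.2 (by linarith)
  · rw [Finset.mem_range, not_lt] at h
    have h' : (J : ℝ) ≤ k := by exact_mod_cast h
    rw [sub_zero, abs_of_nonneg (one_div_nonneg.2 (by linarith))]
    exact one_div_le_one_div_of_le (by linarith) (by linarith)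

theorem abs_meanInv_sub_truncation_le (hm : 1 ≤ m) (ha : -(m : ℝ) < a) (hδ : -(m : ℝ) < δ)
    (J : ℕ) :
    |meanInv m a δ - ∑ j ∈ Finset.range J, degDist m a (m + j) / (m + j + δ)| ≤
      1 / ((m : ℝ) + J + δ) := by
  have hJ0 : (0 : ℝ) ≤ J := Nat.cast_nonneg J
  have hpos : 0 < (m : ℝ) + J + δ := by linarith
  have hs := summable_meanInv hm ha hδ
  have hp := hasSum_degDist hm ha
  have hps := (summable_nat_add_iff J).2 hp.summable
  rw [meanInv, ← hs.sum_add_tsum_nat_add J, add_sub_cancel_left, abs_of_nonneg]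
  · have h1 : ∑' j, degDist m a (m + (j + J)) ≤ 1 := by
      have := hp.summable.sum_add_tsum_nat_add J
      rw [hp.tsum_eq] at this
      have h0 : 0 ≤ ∑ j ∈ Finset.range J, degDist m a (m + j) :=
        Finset.sum_nonneg fun j _ => (degDist_pos hm ha j).le
      linarith
    calc _ ≤ ∑' j, degDist m a (m + (j + J)) / (m + J + δ) :=
          ((summable_nat_add_iff J).2 hs).tsum_le_tsum (fun j => by
            have hj : (0 : ℝ) ≤ j := Nat.cast_nonneg j
            push_cast
            exact div_le_div_of_nonneg_left (degDist_pos hm ha (j + J)).le hpos (by linarith))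
            (hps.div_const _)
      _ = (∑' j, degDist m a (m + (j + J))) / (m + J + δ) := tsum_div_const
      _ ≤ _ := div_le_div_of_nonneg_right h1 hpos.le
  · refine tsum_nonneg fun j => div_nonneg (degDist_pos hm ha (j + J)).le ?_
    have hj : (0 : ℝ) ≤ j := Nat.cast_nonneg j
    push_cast
    linarith

/-- After truncation only finitely many tail proportions remain; they do not involve δ, and their
coefficients are bounded through `δmin`. Hence the uniformity. -/
theorem eventually_abs_meanSum_inv_sub_le {δmin : ℝ} (hm : 1 ≤ m) (ha : -(m : ℝ) < a)
    (hmin : -(m : ℝ) < δmin) {ε : ℝ} (hε : 0 < ε) :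
    ∀ᶠ n : ℕ in atTop, ∀ δ, δmin ≤ δ →
      |meanSum m (nullParam a) (fun x => 1 / ((x : ℝ) + δ)) n 0 / ((n : ℝ) + 2) -
        meanInv m a δ| ≤ ε := by
  have hd : ∀ t, -(m : ℝ) < nullParam a t := fun _ => ha
  obtain ⟨J, hJ⟩ := exists_nat_gt (4 / ε)
  have hJ' : 1 / ((m : ℝ) + J + δmin) ≤ ε / 4 := by
    have h1 : 0 < 4 / ε := by positivity
    calc 1 / ((m : ℝ) + J + δmin) ≤ 1 / (4 / ε) := one_div_le_one_div_of_le h1 (by linarith)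
      _ = ε / 4 := by rw [one_div_div]
  set w : ℕ → ℕ → ℝ := fun j n => meanSum m (nullParam a) (geInd (m + j)) n 0 / ((n : ℝ) + 2) -
    meanSum m (nullParam a) (geInd (m + (j + 1))) n 0 / ((n : ℝ) + 2) with hw
  have hlim : Tendsto (fun n => ∑ j ∈ Finset.range J,
      1 / ((m : ℝ) + δmin) * |w j n - degDist m a (m + j)|) atTop (𝓝 0) := by
    have : ∀ j ∈ Finset.range J, Tendsto (fun n =>
        1 / ((m : ℝ) + δmin) * |w j n - degDist m a (m + j)|) atTop (𝓝 0) := by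
      intro j _
      have h := ((tendsto_tail hm ha j).sub (tendsto_tail hm ha (j + 1))).sub_const
        (degDist m a (m + j))
      rw [← degDist_eq_sub hm ha, sub_self] at h
      simpa using h.abs.const_mul (1 / ((m : ℝ) + δmin))
    simpa using tendsto_finsetSum (Finset.range J) this
  filter_upwards [hlim.eventually_le_const (half_pos hε)] with n hn δ hδ
  have hδ' : -(m : ℝ) < δ := by linarith
  have hn2 : (0 : ℝ) < (n : ℝ) + 2 := by positivity
  have hJ0 : (0 : ℝ) ≤ J := Nat.cast_nonneg J
  have hJδ : 1 / ((m : ℝ) + J + δ) ≤ ε / 4 :=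
    (one_div_le_one_div_of_le (by linarith) (by linarith)).trans hJ'
  have h1 : |meanSum m (nullParam a) (fun x => 1 / ((x : ℝ) + δ)) n 0 / ((n : ℝ) + 2) -
      ∑ j ∈ Finset.range J, 1 / ((m : ℝ) + j + δ) * w j n| ≤ ε / 4 := by
    have h := abs_meanSum_le hd (fun x hx => abs_inv_sub_truncation_le hδ' J hx) n 0
    rw [meanSum_sub hd, meanSum_sum hd] at h
    simp only [meanSum_const_mul, meanSum_sub hd] at h
    refine le_trans ?_ hJδ
    rw [← div_le_iff₀ hn2] at h
    refine le_of_eq_of_le ?_ h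
    conv_rhs => rw [← abs_of_pos hn2]
    rw [← abs_div, sub_div, Finset.sum_div]
    simp only [hw, ← sub_div, mul_div_assoc]
  have h2 := (abs_meanInv_sub_truncation_le hm ha hδ' J).trans hJδ
  have h3 : |∑ j ∈ Finset.range J, 1 / ((m : ℝ) + j + δ) * w j n -
      ∑ j ∈ Finset.range J, degDist m a (m + j) / (m + j + δ)| ≤ ε / 2 := by
    refine le_trans ?_ hn
    rw [← Finset.sum_sub_distrib]
    refine (Finset.abs_sum_le_sum_abs _ _).trans (Finset.sum_le_sum fun j _ => ?_)
    have hj : (0 : ℝ) ≤ j := Nat.cast_nonneg j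
    have e : 1 / ((m : ℝ) + j + δ) * w j n - degDist m a (m + j) / (m + j + δ) =
        1 / ((m : ℝ) + j + δ) * (w j n - degDist m a (m + j)) := by ring
    rw [e, abs_mul, abs_of_nonneg (one_div_nonneg.2 (by linarith))]
    exact mul_le_mul_of_nonneg_right
      (one_div_le_one_div_of_le (by linarith) (by linarith)) (abs_nonneg _)
  rw [abs_le] at h1 h2 h3 ⊢
  constructor <;> linarith

end Truncation

/-! ### Score increments after the changepoint -/

theorem inv_lipschitz {m : ℕ} {δmin δ b : ℝ} (hmin : -(m : ℝ) < δmin) (hδ : δmin ≤ δ)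
    (hb : δmin ≤ b) {x : ℕ} (hx : m ≤ x) :
    |(1 / (((x + 1 : ℕ) : ℝ) + δ) - 1 / ((x : ℝ) + δ)) * (x + b)| ≤
      1 / (m + δmin) ^ 2 * (m + b) := by
  have hx' : (m : ℝ) ≤ x := by exact_mod_cast hx
  set ρ := m + δmin with hρ
  have hρ0 : 0 < ρ := by linarith
  have h1 : 0 < x + δ := by linarith
  have h2 : ρ ≤ x + 1 + δ := by linarith
  have h3 : 0 < x + b := by linarith
  have hmb : ρ ≤ m + b := by linarith
  -- (x + b) / (m + b) = 1 + (x - m) / (m + b) is largest for b = δmin.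
  have key : (x + b) * ρ ≤ (m + b) * (x + δ) := by
    nlinarith [mul_nonneg (sub_nonneg.2 hmb) (sub_nonneg.2 hx'),
      mul_nonneg (by linarith : 0 ≤ m + b) (sub_nonneg.2 hδ)]
  have e : (1 / (((x + 1 : ℕ) : ℝ) + δ) - 1 / ((x : ℝ) + δ)) * (x + b) =
      -((x + b) / ((x + 1 + δ) * (x + δ))) := by
    have : (x + 1 + δ : ℝ) ≠ 0 := by linarith
    push_cast
    field_simp
    ring
  rw [e, abs_neg, abs_of_pos (div_pos h3 (mul_pos (by linarith) h1)), div_mul_eq_mul_div, one_mul,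
    div_le_div_iff₀ (mul_pos (by linarith) h1) (by positivity)]
  calc (x + b) * ρ ^ 2 = (x + b) * ρ * ρ := by ring
    _ ≤ (m + b) * (x + δ) * (x + 1 + δ) :=
      mul_le_mul key h2 hρ0.le (mul_nonneg (by linarith) h1.le)
    _ = _ := by ring

theorem altParam_mem {δ₀ δ₁ δmin : ℝ} (h₀ : δmin ≤ δ₀) (h₁ : δmin ≤ δ₁) (τ t : ℕ) :
    δmin ≤ altParam δ₀ δ₁ τ t := by
  unfold altParam; split_ifs <;> assumption

section Changepoint

variable {m : ℕ} {a b δmin δmax δ : ℝ}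

/-- After the changepoint the average of `1 / (D_v + δ)` changes slowly. -/
theorem abs_meanSum_inv_sub_le_of_change (hm : 1 ≤ m) (hmin : -(m : ℝ) < δmin) (ha : δmin ≤ a)
    (hb : δmin ≤ b) (hδ : δmin ≤ δ) {i : ℕ} (hi : i ≤ m) (s k : ℕ) :
    |meanSum m (altParam a b (s + 1)) (fun x => 1 / ((x : ℝ) + δ)) (s + k) i /
        (((s + k : ℕ) : ℝ) + 2) - meanInv m a δ| ≤
      (m / (m + δmin) ^ 2 + 2 / (m + δmin)) * (((k : ℝ) + 1) / ((s : ℝ) + 2)) +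
        |meanSum m (nullParam a) (fun x => 1 / ((x : ℝ) + δ)) s 0 / ((s : ℝ) + 2) -
          meanInv m a δ| := by
  set d := altParam a b (s + 1) with hdef
  set f : ℕ → ℝ := fun x => 1 / ((x : ℝ) + δ) with hf
  set y := meanInv m a δ
  set ρ := m + δmin with hρ
  have hρ0 : 0 < ρ := by linarith
  have hdm : ∀ t, δmin ≤ d t := fun t => altParam_mem ha hb _ t
  have hd : ∀ t, -(m : ℝ) < d t := fun t => hmin.trans_le (hdm t)
  have hlip : ∀ n x : ℕ, m ≤ x →
      |(f (x + 1) - f x) * (x + d (n + 2))| ≤ 1 / ρ ^ 2 * (m + d (n + 2)) :=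
    fun n x hx => inv_lipschitz hmin hδ (hdm _) hx
  have h0 : meanSum m d f s 0 = meanSum m (nullParam a) f s 0 :=
    meanSum_zero_congr (fun t ht => by rw [hdef, altParam, if_pos ht, nullParam]) f
  have hfm : |f m| ≤ 1 / ρ := by
    rw [hf]
    simp only
    rw [abs_of_pos (one_div_pos.2 (by linarith))]
    exact one_div_le_one_div_of_le hρ0 (by linarith)
  have hy : |y| ≤ 1 / ρ := by
    rw [abs_of_nonneg (meanInv_nonneg hm (by linarith) (by linarith))]
    exact (meanInv_le hm (by linarith) (by linarith)).trans
      (one_div_le_one_div_of_le hρ0 (by linarith))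
  -- A new vertex changes the sum by at most 1/ρ² for each of its m edges, plus its own term, at
  -- most 1/ρ.
  have hk : |meanSum m d f (s + k) 0 - meanSum m d f s 0| ≤ (m / ρ ^ 2 + 1 / ρ) * k := by
    induction k with
    | zero => simp
    | succ k ih =>
      have h1 := abs_meanSum_next_sub_le hd (hlip (s + k))
      have h2 := abs_sub_le (meanSum m d f (s + (k + 1)) 0) (meanSum m d f (s + k) 0)
        (meanSum m d f s 0)
      have e : 1 / ρ ^ 2 * (m : ℝ) = m / ρ ^ 2 := by ring
      rw [← add_assoc] at h2 ⊢
      push_cast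
      linarith
  have hi' : |meanSum m d f (s + k) i - meanSum m d f (s + k) 0| ≤ m / ρ ^ 2 := by
    refine (abs_meanSum_sub_zero_le hd (hlip (s + k)) i).trans ?_
    have : (i : ℝ) ≤ m := by exact_mod_cast hi
    rw [div_mul_eq_mul_div, one_mul]
    gcongr
  have hs2 : (0 : ℝ) < (s : ℝ) + 2 := by positivity
  have hsk : (0 : ℝ) < ((s + k : ℕ) : ℝ) + 2 := by positivity
  have hle : (s : ℝ) + 2 ≤ ((s + k : ℕ) : ℝ) + 2 := by
    push_cast
    linarith [(Nat.cast_nonneg k : (0 : ℝ) ≤ k)]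
  have hsplit : meanSum m d f (s + k) i - y * (((s + k : ℕ) : ℝ) + 2) =
      (meanSum m d f (s + k) i - meanSum m d f (s + k) 0) +
        (meanSum m d f (s + k) 0 - meanSum m d f s 0) +
        (meanSum m (nullParam a) f s 0 / ((s : ℝ) + 2) - y) * ((s : ℝ) + 2) + -(k * y) := by
    rw [sub_mul, div_mul_cancel₀ _ hs2.ne', h0]
    push_cast
    ring
  have hbound : |meanSum m d f (s + k) i - y * (((s + k : ℕ) : ℝ) + 2)| ≤
      ((m / ρ ^ 2 + 2 / ρ) * (((k : ℝ) + 1) / ((s : ℝ) + 2)) +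
        |meanSum m (nullParam a) f s 0 / ((s : ℝ) + 2) - y|) * ((s : ℝ) + 2) := by
    rw [hsplit]
    refine (abs_add_le _ _).trans ?_
    have h1 := abs_add_three (meanSum m d f (s + k) i - meanSum m d f (s + k) 0)
      (meanSum m d f (s + k) 0 - meanSum m d f s 0)
      ((meanSum m (nullParam a) f s 0 / ((s : ℝ) + 2) - y) * ((s : ℝ) + 2))
    rw [abs_mul _ ((s : ℝ) + 2), abs_of_pos hs2] at h1
    have h2 : |-(k * y)| ≤ k * (1 / ρ) := by
      rw [abs_neg, abs_mul, Nat.abs_cast]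
      gcongr
    rw [add_mul, mul_assoc, div_mul_cancel₀ _ hs2.ne']
    have h3 : 0 ≤ 1 / ρ := by positivity
    have e : (m / ρ ^ 2 + 2 / ρ) * ((k : ℝ) + 1) =
        m / ρ ^ 2 + (m / ρ ^ 2 + 1 / ρ) * k + k * (1 / ρ) + 2 * (1 / ρ) := by ring
    linarith
  have e : meanSum m d f (s + k) i / (((s + k : ℕ) : ℝ) + 2) - y =
      (meanSum m d f (s + k) i - y * (((s + k : ℕ) : ℝ) + 2)) / (((s + k : ℕ) : ℝ) + 2) := by
    rw [sub_div, mul_div_cancel_right₀ _ hsk.ne']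
  rw [e, abs_div, abs_of_pos hsk, div_le_iff₀ hsk]
  exact hbound.trans (mul_le_mul_of_nonneg_left hle (by positivity))

/-- The mean increment of the score per edge, if the attachment parameter is `b` and the degrees
follow the limiting distribution with parameter `a`. -/
def drift (m : ℕ) (a b δ : ℝ) : ℝ := (1 + (b - δ) * meanInv m a δ) / (2 * m + b)

/-- Because (x + b) / (x + δ) = 1 + (b - δ) / (x + δ), the increment depends on the degrees only
through the average of 1 / (D_v + δ). -/
theorem meanSum_scoreWeight_succ {d : ℕ → ℝ} (hd : ∀ t, -(m : ℝ) < d t) (hδ : -(m : ℝ) < δ)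
    (n i : ℕ) :
    meanSum m d (scoreWeight m δ) n (i + 1) = meanSum m d (scoreWeight m δ) n i +
      (1 + (d (n + 2) - δ) * (meanSum m d (fun x => 1 / ((x : ℝ) + δ)) n i / ((n : ℝ) + 2))) *
        (((n : ℝ) + 2) / normConst m (n + 2) i (d (n + 2))) := by
  have hn : (n : ℝ) + 2 ≠ 0 := by positivity
  have hS := (normConst_pos (m := m) (t := n + 2) (by omega) i (hd (n + 2))).ne'
  have hweight : ∀ x : ℕ, m ≤ x → (scoreWeight m δ (x + 1) - scoreWeight m δ x) *
      (x + d (n + 2)) = 1 + (d (n + 2) - δ) * (1 / ((x : ℝ) + δ)) := by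
    intro x hx
    have hx' : (m : ℝ) ≤ x := by exact_mod_cast hx
    have : (x + δ : ℝ) ≠ 0 := by linarith
    rw [scoreWeight_succ δ hx]
    field_simp
    ring
  rw [meanSum_succ hd, meanSum_congr hd hweight, meanSum_add hd, meanSum_const, meanSum_const_mul]
  field_simp

theorem eventually_abs_score_increment_le (hm : 1 ≤ m) (hmin : -(m : ℝ) < δmin)
    (ha : a ∈ Set.Icc δmin δmax) (hb : b ∈ Set.Icc δmin δmax) {σ K : ℕ → ℕ}
    (hσ : Tendsto σ atTop atTop)
    (hK : Tendsto (fun N => ((K N : ℝ) + 1) / ((σ N : ℝ) + 2)) atTop (𝓝 0))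
    {ε : ℝ} (hε : 0 < ε) :
    ∀ᶠ N in atTop, ∀ δ ∈ Set.Icc δmin δmax, ∀ k < K N, ∀ i < m,
      |meanSum m (altParam a b (σ N + 1)) (scoreWeight m δ) (σ N + k) (i + 1) -
        meanSum m (altParam a b (σ N + 1)) (scoreWeight m δ) (σ N + k) i - drift m a b δ| ≤ ε := by
  have hm' : (1 : ℝ) ≤ m := by exact_mod_cast hm
  set ρ := m + δmin with hρ
  have hρ0 : 0 < ρ := by linarith
  set D := δmax - δmin with hD
  have hD0 : 0 ≤ D := by linarith [ha.1, ha.2]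
  set C := m / ρ ^ 2 + 2 / ρ with hC
  have hC0 : 0 ≤ C := by positivity
  have hq : ∀ᶠ n : ℕ in atTop, ∀ i ∈ Finset.range m,
      (1 + D / ρ) * |((n : ℝ) + 2) / normConst m (n + 2) i b - 1 / (2 * m + b)| ≤ ε / 2 := by
    rw [eventually_all_finset]
    intro i _
    have h := ((tendsto_div_normConst hm (hmin.trans_le hb.1) i).sub_const (1 / (2 * m + b))).abs
    rw [sub_self, abs_zero] at h
    have h' := h.const_mul (1 + D / ρ)
    rw [mul_zero] at h'
    exact h'.eventually_le_const (half_pos hε)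
  obtain ⟨N₁, hN₁⟩ := eventually_atTop.1 hq
  -- One η pays for convergence at the changepoint, one for the change afterwards; the `+ 1` keeps
  -- the denominator positive when D = 0.
  set η := ε / 2 / (2 * (D / ρ + 1)) with hη
  have hη0 : 0 < η := by positivity
  have hY := hσ.eventually (eventually_abs_meanSum_inv_sub_le hm (hmin.trans_le ha.1) hmin hη0)
  have hK' := (hK.const_mul C)
  rw [mul_zero] at hK'
  filter_upwards [hY, hK'.eventually_le_const hη0, hσ.eventually_ge_atTop N₁] with N hYN hKN hσN
    δ hδ k hk i hi
  set d := altParam a b (σ N + 1) with hdef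
  have hdm : ∀ t, δmin ≤ d t := fun t => altParam_mem ha.1 hb.1 _ t
  have hd : ∀ t, -(m : ℝ) < d t := fun t => hmin.trans_le (hdm t)
  have hδ' : -(m : ℝ) < δ := hmin.trans_le hδ.1
  have hdk : d (σ N + k + 2) = b := by rw [hdef, altParam, if_neg (by omega)]
  rw [meanSum_scoreWeight_succ hd hδ', add_sub_cancel_left, hdk]
  have hn0 : (0 : ℝ) < ((σ N + k : ℕ) : ℝ) + 2 := by positivity
  set u := meanSum m d (fun x => 1 / ((x : ℝ) + δ)) (σ N + k) i / (((σ N + k : ℕ) : ℝ) + 2)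
  set q := (((σ N + k : ℕ) : ℝ) + 2) / normConst m (σ N + k + 2) i b with hqdef
  have hqN : (1 + D / ρ) * |q - 1 / (2 * m + b)| ≤ ε / 2 :=
    hN₁ (σ N + k) (by omega) i (Finset.mem_range.2 hi)
  have hu : |u - meanInv m a δ| ≤ 2 * η := by
    refine (abs_meanSum_inv_sub_le_of_change hm hmin ha.1 hb.1 hδ.1 hi.le (σ N) k).trans ?_
    have h1 : C * (((k : ℝ) + 1) / ((σ N : ℝ) + 2)) ≤ C * (((K N : ℝ) + 1) / ((σ N : ℝ) + 2)) := by
      gcongr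
    linarith [hYN δ hδ.1]
  have hu1 : |u| ≤ 1 / ρ := by
    rw [abs_div, abs_of_pos hn0, div_le_iff₀ hn0]
    refine abs_meanSum_le hd (fun x hx => ?_) _ _
    have hx' : (m : ℝ) ≤ x := by exact_mod_cast hx
    have := hδ.1
    rw [abs_of_pos (one_div_pos.2 (by linarith))]
    exact one_div_le_one_div_of_le hρ0 (by linarith)
  have hbδ : |b - δ| ≤ D := abs_sub_le_of_le_of_le hb.1 hb.2 hδ.1 hδ.2
  have h2 : 1 / (2 * m + b) ≤ 1 / ρ := one_div_le_one_div_of_le hρ0 (by linarith [hb.1])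
  have h20 : 0 ≤ 1 / (2 * m + b) := one_div_nonneg.2 (by linarith [hb.1])
  have e : (1 + (b - δ) * u) * q - drift m a b δ =
      (1 + (b - δ) * u) * (q - 1 / (2 * m + b)) +
        (b - δ) * (u - meanInv m a δ) * (1 / (2 * m + b)) := by
    rw [drift]
    ring
  have h3 : |1 + (b - δ) * u| ≤ 1 + D / ρ := by
    refine (abs_add_le _ _).trans ?_
    rw [abs_one, abs_mul, div_eq_mul_one_div D]
    gcongr
  have h4 : |(b - δ) * (u - meanInv m a δ) * (1 / (2 * m + b))| ≤ ε / 2 := by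
    rw [abs_mul, abs_mul, abs_of_nonneg h20]
    calc |b - δ| * |u - meanInv m a δ| * (1 / (2 * m + b)) ≤ D * (2 * η) * (1 / ρ) := by gcongr
      _ = D / ρ * (2 * η) := by ring
      _ ≤ (D / ρ + 1) * (2 * η) := by gcongr; linarith
      _ = ε / 2 := by rw [hη]; field_simp
  rw [e]
  refine (abs_add_le _ _).trans ?_
  rw [abs_mul]
  have := mul_le_mul_of_nonneg_right h3 (abs_nonneg (q - 1 / (2 * m + b)))
  linarith

/-- Sums the increments over `m` edges for each of `K N` vertices; a completed vertex enters with
`scoreWeight` 0. The case b = a covers the null model. -/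
theorem eventually_abs_score_change_le (hm : 1 ≤ m) (hmin : -(m : ℝ) < δmin)
    (ha : a ∈ Set.Icc δmin δmax) (hb : b ∈ Set.Icc δmin δmax) {σ K : ℕ → ℕ}
    (hσ : Tendsto σ atTop atTop)
    (hK : Tendsto (fun N => ((K N : ℝ) + 1) / ((σ N : ℝ) + 2)) atTop (𝓝 0))
    {ε : ℝ} (hε : 0 < ε) :
    ∀ᶠ N in atTop, ∀ δ ∈ Set.Icc δmin δmax,
      |meanSum m (altParam a b (σ N + 1)) (scoreWeight m δ) (σ N + K N) 0 -
        meanSum m (nullParam a) (scoreWeight m δ) (σ N) 0 - m * K N * drift m a b δ| ≤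
          ε * K N := by
  have hm' : (0 : ℝ) < m := by exact_mod_cast hm
  filter_upwards [eventually_abs_score_increment_le hm hmin ha hb hσ hK (div_pos hε hm')]
    with N hN δ hδ
  set d := altParam a b (σ N + 1) with hdef
  have hd : ∀ t, -(m : ℝ) < d t := fun t => hmin.trans_le (altParam_mem ha.1 hb.1 _ t)
  set f := scoreWeight m δ
  set L := drift m a b δ
  have h0 : meanSum m d f (σ N) 0 = meanSum m (nullParam a) f (σ N) 0 :=
    meanSum_zero_congr (fun t ht => by rw [hdef, altParam, if_pos ht, nullParam]) f
  have hfm : f m = 0 := by simp [f, scoreWeight]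
  rw [← h0]
  have hvertex : ∀ k < K N, ∀ i ≤ m,
      |meanSum m d f (σ N + k) i - meanSum m d f (σ N + k) 0 - i * L| ≤ ε / m * i := by
    intro k hk i
    induction i with
    | zero => simp
    | succ i ih =>
      intro hi
      have h1 := hN δ hδ k hk i (by omega)
      have h2 := ih (by omega)
      rw [abs_le] at h1 h2 ⊢
      push_cast
      constructor <;> linarith
  have hall : ∀ k ≤ K N,
      |meanSum m d f (σ N + k) 0 - meanSum m d f (σ N) 0 - m * k * L| ≤ ε * k := by
    intro k
    induction k with
    | zero => simp
    | succ k ih =>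
      intro hk
      have h1 := hvertex k (by omega) m le_rfl
      have h2 := ih (by omega)
      rw [div_mul_cancel₀ _ hm'.ne'] at h1
      rw [← add_assoc, meanSum_next hd, hfm]
      rw [abs_le] at h1 h2 ⊢
      push_cast
      constructor <;> linarith
  exact hall (K N) le_rfl

end Changepoint

/-! ### The constant κ and its lower bound -/

theorem kappa_eq_drift {m : ℕ} {c a b δ : ℝ} (ha : 2 * m + a ≠ 0) (hb : 2 * m + b ≠ 0) :
    kappa m c b a δ = c * m * (drift m a b δ - drift m a a δ) := by
  rw [kappa, tsum_kappaTerm, drift, drift, div_sub_div _ _ hb ha]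
  ring

/-- The Jensen gap decreases in δ, so its value at `δmax` is a uniform bound. -/
theorem exists_le_abs_kappa {m : ℕ} {c a b δmin δmax : ℝ} (hm : 1 ≤ m) (hmin : -(m : ℝ) < δmin)
    (ha : a ∈ Set.Icc δmin δmax) (hb : b ∈ Set.Icc δmin δmax) (hab : b ≠ a) (hc : 0 < c) :
    ∃ κ₀ > 0, ∀ δ ∈ Set.Icc δmin δmax, κ₀ ≤ |kappa m c b a δ| := by
  have hm' : (1 : ℝ) ≤ m := by exact_mod_cast hm
  have hp : 0 < degDist m a m := degDist_pos hm (hmin.trans_le ha.1) 0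
  have h1 : 0 < |b - a| := abs_pos.2 (sub_ne_zero.2 hab)
  have h2 : 0 < 2 * m + a := by linarith [ha.1]
  have h3 : 0 < 2 * m + b := by linarith [hb.1]
  have h4 : 0 < m + δmax := by linarith [ha.1, ha.2]
  have h5 : 0 < 2 * m + δmax := by linarith
  have hcm : 0 < c * m / ((2 * m + b) * (2 * m + a)) := by positivity
  refine ⟨|b - a| * (c * m / ((2 * m + b) * (2 * m + a))) *
    (m ^ 2 / ((m + δmax) * (2 * m + δmax)) * degDist m a m), by positivity, fun δ hδ => ?_⟩
  have h6 : 0 < m + δ := by linarith [hδ.1]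
  have h7 : 0 < 2 * m + δ := by linarith
  have hδm := hδ.2
  have hJ := jensen_kappaTerm hm (hmin.trans_le ha.1) (hmin.trans_le hδ.1)
  have h8 : m ^ 2 / ((m + δmax) * (2 * m + δmax)) * degDist m a m ≤
      m ^ 2 / ((m + δ) * (2 * m + δ)) * degDist m a m := by gcongr
  rw [kappa, abs_mul, abs_mul, abs_of_pos hcm]
  gcongr
  exact le_trans (by linarith) (le_abs_self _)

/-! ### Asymptotics of the changepoint -/

section Changepoints

variable {c γ : ℝ} {τ : ℕ → ℕ}

theorem tendsto_natCast_rpow_sub_one (hγ : γ < 1) :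
    Tendsto (fun n : ℕ => (n : ℝ) ^ (γ - 1)) atTop (𝓝 0) := by
  have h := (tendsto_rpow_neg_atTop (sub_pos.2 hγ)).comp (tendsto_natCast_atTop_atTop (R := ℝ))
  rw [neg_sub] at h
  exact h

theorem tendsto_changepoint_div (hγ : γ < 1)
    (hτ : ∀ᶠ n : ℕ in atTop, |(τ n : ℝ) - ((n : ℝ) - c * (n : ℝ) ^ γ)| < 1) :
    Tendsto (fun n : ℕ => (τ n : ℝ) / n) atTop (𝓝 1) := by
  have h1 : Tendsto (fun n : ℕ => |c| * (n : ℝ) ^ (γ - 1) + 1 / (n : ℝ)) atTop (𝓝 0) := by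
    simpa using ((tendsto_natCast_rpow_sub_one hγ).const_mul |c|).add
      (tendsto_one_div_atTop_nhds_zero_nat (𝕜 := ℝ))
  rw [tendsto_iff_norm_sub_tendsto_zero]
  refine squeeze_zero' (Eventually.of_forall fun _ => norm_nonneg _) ?_ h1
  filter_upwards [hτ, eventually_gt_atTop 0] with n hn hn0
  have hn' : (0 : ℝ) < n := by exact_mod_cast hn0
  have e : (τ n : ℝ) / n - 1 =
      ((τ n - (n - c * (n : ℝ) ^ γ)) - c * (n : ℝ) ^ γ) / n := by
    field_simp
    ring
  rw [e, norm_div, Real.norm_of_nonneg hn'.le, Real.rpow_sub_one hn'.ne', ← mul_div_assoc,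
    ← add_div, Real.norm_eq_abs]
  refine div_le_div_of_nonneg_right ?_ hn'.le
  refine (abs_sub _ _).trans ?_
  rw [abs_mul c, abs_of_nonneg (Real.rpow_nonneg hn'.le γ)]
  linarith

theorem tendsto_changepoint (hγ : γ < 1)
    (hτ : ∀ᶠ n : ℕ in atTop, |(τ n : ℝ) - ((n : ℝ) - c * (n : ℝ) ^ γ)| < 1) :
    Tendsto τ atTop atTop := by
  rw [← tendsto_natCast_atTop_iff (R := ℝ)]
  refine ((tendsto_changepoint_div hγ hτ).pos_mul_atTop one_pos
    tendsto_natCast_atTop_atTop).congr' ?_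
  filter_upwards [eventually_gt_atTop 0] with n hn
  have hn' : (n : ℝ) ≠ 0 := by exact_mod_cast hn.ne'
  exact div_mul_cancel₀ _ hn'

theorem tendsto_sub_changepoint_div (hγ0 : 0 < γ)
    (hτ : ∀ᶠ n : ℕ in atTop, |(τ n : ℝ) - ((n : ℝ) - c * (n : ℝ) ^ γ)| < 1) :
    Tendsto (fun n : ℕ => ((n : ℝ) - τ n) / (n : ℝ) ^ γ) atTop (𝓝 c) := by
  have hpow : Tendsto (fun n : ℕ => (n : ℝ) ^ γ) atTop atTop :=
    (tendsto_rpow_atTop hγ0).comp tendsto_natCast_atTop_atTop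
  rw [tendsto_iff_norm_sub_tendsto_zero]
  refine squeeze_zero' (Eventually.of_forall fun _ => norm_nonneg _) ?_
    (hpow.const_div_atTop 1)
  filter_upwards [hτ, hpow.eventually_gt_atTop 0] with n hn hn0
  have e : ((n : ℝ) - τ n) / (n : ℝ) ^ γ - c =
      -((τ n - (n - c * (n : ℝ) ^ γ)) / (n : ℝ) ^ γ) := by
    field_simp
    ring
  rw [e, norm_neg, norm_div, Real.norm_of_nonneg hn0.le, Real.norm_eq_abs]
  exact div_le_div_of_nonneg_right hn.le hn0.le

theorem eventually_changepoint_lt (hc : 0 < c) (hγ0 : 0 < γ)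
    (hτ : ∀ᶠ n : ℕ in atTop, |(τ n : ℝ) - ((n : ℝ) - c * (n : ℝ) ^ γ)| < 1) :
    ∀ᶠ n in atTop, τ n < n := by
  filter_upwards [(tendsto_sub_changepoint_div hγ0 hτ).eventually_const_lt hc] with n hn
  have h : (0 : ℝ) < (n : ℝ) - τ n := by
    by_contra h
    exact hn.not_ge (div_nonpos_of_nonpos_of_nonneg (not_lt.1 h)
      (Real.rpow_nonneg (Nat.cast_nonneg n) γ))
  exact_mod_cast sub_pos.1 h

theorem tendsto_steps_div (hc : 0 < c) (hγ0 : 0 < γ) (hγ : γ < 1)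
    (hτ : ∀ᶠ n : ℕ in atTop, |(τ n : ℝ) - ((n : ℝ) - c * (n : ℝ) ^ γ)| < 1) :
    Tendsto (fun n => (((n - τ n : ℕ) : ℝ) + 1) / (((τ n - 1 : ℕ) : ℝ) + 2)) atTop (𝓝 0) := by
  have h1 := tendsto_changepoint_div hγ hτ
  have h0 := tendsto_one_div_atTop_nhds_zero_nat (𝕜 := ℝ)
  have h := ((tendsto_const_nhds (x := (1 : ℝ))).sub h1 |>.add h0).div (h1.add h0) (by norm_num)
  simp only [sub_self, add_zero, div_one] at h
  refine h.congr' ?_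
  filter_upwards [eventually_gt_atTop 0, eventually_changepoint_lt hc hγ0 hτ,
    (tendsto_changepoint hγ hτ).eventually_ge_atTop 1] with n hn hlt hge
  have hn' : (0 : ℝ) < n := by exact_mod_cast hn
  have h3 : (0 : ℝ) < τ n := by exact_mod_cast hge
  simp only [Pi.div_apply]
  rw [Nat.cast_sub hlt.le, Nat.cast_sub hge]
  push_cast
  have h4 : (τ n : ℝ) - 1 + 2 ≠ 0 := by linarith
  have h5 : (τ n : ℝ) / n + 1 / n ≠ 0 := by positivity
  rw [div_eq_div_iff h5 h4]
  field_simp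
  ring

end Changepoints

/-! ### Conclusion -/

theorem altParam_self (a : ℝ) (τ : ℕ) : altParam a a τ = nullParam a := by
  funext t
  simp [altParam, nullParam]

/-- The difference of the expected scores is `kappa * n ^ γ` up to a small multiple of `n ^ γ`. -/
theorem eventually_abs_expect_score_sub_le {m : ℕ} {a b δmin δmax c γ : ℝ} {τ : ℕ → ℕ}
    (hm : 1 ≤ m) (hmin : -(m : ℝ) < δmin) (ha : a ∈ Set.Icc δmin δmax)
    (hb : b ∈ Set.Icc δmin δmax) (hc : 0 < c) (hγ0 : 0 < γ) (hγ : γ < 1)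
    (hτ : ∀ᶠ n : ℕ in atTop, |(τ n : ℝ) - ((n : ℝ) - c * (n : ℝ) ^ γ)| < 1)
    {ε : ℝ} (hε : 0 < ε) :
    ∀ᶠ n : ℕ in atTop, ∀ δ ∈ Set.Icc δmin δmax,
      |((n : ℝ) + 1) * (expect (graphLaw m (altParam a b (τ n)) n) (score m n δ) -
          expect (graphLaw m (nullParam a) n) (score m n δ)) -
        kappa m c b a δ * (n : ℝ) ^ γ| ≤ (ε + ε * |kappa m c b a δ|) * (n : ℝ) ^ γ := by
  have hlim := tendsto_sub_changepoint_div hγ0 hτ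
  have hσ : Tendsto (fun n => τ n - 1) atTop atTop :=
    (tendsto_sub_atTop_nat 1).comp (tendsto_changepoint hγ hτ)
  have hK := tendsto_steps_div hc hγ0 hγ hτ
  -- Since n - τ ≤ 2 c n^γ eventually, each of the two laws contributes an error of at most (ε / 2)
  -- n^γ. The term with |κ| comes from replacing n - τ by c n^γ.
  have hε' : 0 < ε / (4 * c) := by positivity
  have hclose := (tendsto_iff_norm_sub_tendsto_zero.1 hlim).eventually_le_const (mul_pos hε hc)
  filter_upwards [eventually_abs_score_change_le hm hmin ha hb hσ hK hε',
    eventually_abs_score_change_le hm hmin ha ha hσ hK hε', eventually_gt_atTop 0,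
    eventually_changepoint_lt hc hγ0 hτ, (tendsto_changepoint hγ hτ).eventually_ge_atTop 1,
    hlim.eventually_le_const (by linarith : c < 2 * c), hclose]
    with n hb' ha' hn hlt hge h2c hnear δ hδ
  have h1 := hb' δ hδ
  have h0 := ha' δ hδ
  obtain ⟨k, rfl⟩ : ∃ k, n = k + 1 := ⟨n - 1, by omega⟩
  have hn0 : (0 : ℝ) < ((k + 1 : ℕ) : ℝ) := by positivity
  have hpow : 0 < ((k + 1 : ℕ) : ℝ) ^ γ := Real.rpow_pos_of_pos hn0 γ
  have e1 : τ (k + 1) - 1 + 1 = τ (k + 1) := by omega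
  have e2 : τ (k + 1) - 1 + (k + 1 - τ (k + 1)) = k := by omega
  rw [e1, e2, Nat.cast_sub hlt.le] at h1
  rw [e1, e2, altParam_self, Nat.cast_sub hlt.le] at h0
  have hda : ∀ t, -(m : ℝ) < nullParam a t := fun _ => hmin.trans_le ha.1
  have hdb : ∀ t, -(m : ℝ) < altParam a b (τ (k + 1)) t :=
    fun t => hmin.trans_le (altParam_mem ha.1 hb.1 _ t)
  have hκ := kappa_eq_drift (m := m) (c := c) (a := a) (b := b) (δ := δ)
    (by have := ha.1; have := (Nat.cast_nonneg m : (0 : ℝ) ≤ m); linarith)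
    (by have := hb.1; have := (Nat.cast_nonneg m : (0 : ℝ) ≤ m); linarith)
  set κ := kappa m c b a δ
  rw [mul_sub, expect_score hdb, expect_score hda, sub_sub_sub_cancel_right]
  set x : ℝ := ((k + 1 : ℕ) : ℝ) ^ γ
  set K : ℝ := ((k + 1 : ℕ) : ℝ) - τ (k + 1)
  rw [div_le_iff₀ hpow] at h2c
  have hnear' : |K - c * x| ≤ ε * c * x := by
    rw [Real.norm_eq_abs, div_sub' hpow.ne', abs_div, abs_of_pos hpow, div_le_iff₀ hpow] at hnear
    rwa [mul_comm c x]
  set L := drift m a b δ - drift m a a δ with hL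
  have hmain : |m * K * L - κ * x| ≤ ε * |κ| * x := by
    have e : m * K * L - κ * x = (m * L) * (K - c * x) := by rw [hκ]; ring
    have e' : |κ| = c * |m * L| := by
      rw [hκ, mul_assoc, abs_mul, abs_of_pos hc]
    rw [e, abs_mul, e']
    calc |m * L| * |K - c * x| ≤ |m * L| * (ε * c * x) := by gcongr
      _ = _ := by ring
  have hKε : ε / (4 * c) * K ≤ ε / 2 * x := by
    calc ε / (4 * c) * K ≤ ε / (4 * c) * (2 * c * x) := by gcongr
      _ = ε / 2 * x := by field_simp; ring
  rw [abs_le] at h1 h0 hmain ⊢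
  constructor <;> linarith

end

end PrefAttach

open PrefAttach in
theorem proposition8p2 (m : ℕ) (hm : 1 ≤ m) (δmin δmax δ₀ δ₁ c γ : ℝ)
    (hmin : -(m : ℝ) < δmin)
    (h₀ : δ₀ ∈ Set.Ioo δmin δmax) (h₁ : δ₁ ∈ Set.Ioo δmin δmax)
    (hc : 0 < c) (hγ : 1 / 2 < γ) (hγ' : γ < 1)
    (τ : ℕ → ℕ) (hτ : ∀ᶠ n : ℕ in atTop, |(τ n : ℝ) - ((n : ℝ) - c * (n : ℝ) ^ γ)| < 1) :
    (∀ δ ∈ Set.Icc δmin δmax, Summable (PrefAttach.kappaTerm m δ₀ δ)) ∧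
    ∃ r : ℕ → ℝ → ℝ,
      TendstoUniformlyOn r (fun _ => 0) atTop (Set.Icc δmin δmax) ∧
      ∀ᶠ n : ℕ in atTop, ∀ δ ∈ Set.Icc δmin δmax,
        ((n : ℝ) + 1) *
          (PrefAttach.expect
              (PrefAttach.graphLaw m (PrefAttach.altParam δ₀ δ₁ (τ n)) n)
              (PrefAttach.score m n δ)
            - PrefAttach.expect
              (PrefAttach.graphLaw m (PrefAttach.nullParam δ₀) n)
              (PrefAttach.score m n δ))
          = PrefAttach.kappa m c δ₁ δ₀ δ * (n : ℝ) ^ γ * (1 + r n δ) := by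
  have hγ0 : 0 < γ := by linarith
  have ha := Set.Ioo_subset_Icc_self h₀
  have hb := Set.Ioo_subset_Icc_self h₁
  refine ⟨fun δ hδ => summable_kappaTerm hm (hmin.trans_le ha.1) (hmin.trans_le hδ.1), ?_⟩
  -- For equal parameters κ = 0 and the laws coincide; otherwise the remainder is obtained by
  -- dividing by κ.
  rcases eq_or_ne δ₁ δ₀ with rfl | hne
  · refine ⟨fun _ _ => 0, Metric.tendstoUniformlyOn_iff.2 fun ε hε =>
      Eventually.of_forall fun _ _ _ => by simpa using hε, Eventually.of_forall fun n δ _ => ?_⟩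
    rw [altParam_self, sub_self, mul_zero, kappa, sub_self]
    ring
  obtain ⟨κ₀, hκ₀, hκ⟩ := exists_le_abs_kappa hm hmin ha hb hne hc
  set Δ : ℕ → ℝ → ℝ := fun n δ => ((n : ℝ) + 1) *
    (expect (graphLaw m (altParam δ₀ δ₁ (τ n)) n) (score m n δ) -
      expect (graphLaw m (nullParam δ₀) n) (score m n δ)) with hΔ
  have hpow : ∀ᶠ n : ℕ in atTop, 0 < (n : ℝ) ^ γ := by
    filter_upwards [eventually_gt_atTop 0] with n hn
    exact Real.rpow_pos_of_pos (by exact_mod_cast hn) γ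
  refine ⟨fun n δ => Δ n δ / (kappa m c δ₁ δ₀ δ * (n : ℝ) ^ γ) - 1, ?_, ?_⟩
  · rw [Metric.tendstoUniformlyOn_iff]
    intro ε hε
    -- From 1 ≤ |κ| / κ₀ one gets ε' (1 + |κ|) ≤ ε' (1 / κ₀ + 1) |κ| = (ε / 2) |κ|.
    have hε' : 0 < ε / 2 / (1 / κ₀ + 1) := by positivity
    filter_upwards [hpow, eventually_abs_expect_score_sub_le hm hmin ha hb hc hγ0 hγ' hτ hε']
      with n hn hbound δ hδ
    have hκδ := hκ δ hδ
    have hκpos : 0 < |kappa m c δ₁ δ₀ δ| := hκ₀.trans_le hκδ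
    have hκn : kappa m c δ₁ δ₀ δ * (n : ℝ) ^ γ ≠ 0 := mul_ne_zero (abs_pos.1 hκpos) hn.ne'
    rw [dist_comm, Real.dist_eq, sub_zero, div_sub_one hκn, abs_div, abs_mul, abs_of_pos hn]
    refine lt_of_le_of_lt ?_ (half_lt_self hε)
    rw [div_le_iff₀ (by positivity)]
    refine (hbound δ hδ).trans ?_
    rw [← mul_assoc]
    refine mul_le_mul_of_nonneg_right ?_ hn.le
    set η := ε / 2 / (1 / κ₀ + 1) with hη
    have h1 : 1 ≤ 1 / κ₀ * |kappa m c δ₁ δ₀ δ| := by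
      rw [one_div, ← div_eq_inv_mul]
      exact (one_le_div hκ₀).2 hκδ
    have h2 : ε / 2 = η * (1 / κ₀ + 1) := by rw [hη]; field_simp
    rw [h2]
    nlinarith [mul_le_mul_of_nonneg_left h1 hε'.le]
  · filter_upwards [hpow] with n hn δ hδ
    have hκn : kappa m c δ₁ δ₀ δ * (n : ℝ) ^ γ ≠ 0 :=
      mul_ne_zero (abs_pos.1 (hκ₀.trans_le (hκ δ hδ))) hn.ne'
    rw [add_sub_cancel, mul_div_cancel₀ _ hκn]
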